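/- Identify the plane with $\mathbb{C}$ and let $\sigma\subseteq\mathbb{C}$ be nonempty and compact. For a list $S=[x_0,\dots,x_n]$ of points of $\sigma$ with $n\ge 1$ and a line $\ell$, let $\mathrm{vf}(S,\ell)$ be the number of indices $0\le i<n$ such that $x_i,x_{i+1}$ lie strictly on opposite sides of $\ell$, or $i=0$ and $x_0\in\ell$, or $i>0$, $x_i\in\ell$ and $x_{i-1}\notin\ell$. Let $\mathrm{vf}(S)=\max_\ell \mathrm{vf}(S,\ell)$, and $\mathrm{vf}([x_0])=1$. For $f:\sigma\to\mathbb{C}$ let $$\mathrm{var}(f,\sigma)=\sup_S \frac{1}{\mathrm{vf}(S)}\sum_{i=1}^n|f(x_i)-f(x_{i-1})|,\qquad \|f\|_{BV(\sigma)}=\|f\|_\infty+\mathrm{var}(f,\sigma).$$ Then $BV(\sigma)=\{f:\|f\|_{BV(\sigma)}<\infty\}$ is a Banach algebra under pointwise operations. Let $LG$ be the class of compact connected nonempty subsets of $\mathbb{C}$ that are finite unions of compact line segments. A proper representation of $\sigma\in LG$ is a decomposition $\sigma=\bigcup_{k=1}^m s_k$ into line segments such that distinct segments meet only in common endpoints,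 the segments being non-degenerate unless $\sigma$ is a single point. Given one, put $\|f\|_{LG(\sigma)}=\|f\|_\infty+\sum_{k=1}^m\mathrm{var}(f|_{s_k},s_k)$. **Theorem.** Suppose that $\sigma,\tau\in LG$ are homeomorphic. Then there are proper representations $\sigma=\bigcup_{k=1}^m s_k$ and $\tau=\bigcup_{k=1}^m t_k$ with the same number $m$ of segments and a homeomorphism $\phi:\sigma\to\tau$ that maps each $s_k$ affinely onto $t_k$, such that $\Phi(f)=f\circ\phi^{-1}$ defines an isomorphism of Banach algebras from $BV(\sigma)$ onto $BV(\tau)$ (a linear and multiplicative bijection that is continuous together with its inverse). Moreover $\Phi$ is isometric for the $LG$ norms: for all $f\in BV(\sigma)$, and whichever proper representations of $\sigma$ and $\tau$ are used to compute the $LG$ norms, $\|\Phi(f)\|_{LG(\tau)}=\|f\|_{LG(\sigma)}<\infty$. -/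

import Mathlib

open scoped ENNReal

namespace PlaneBV

/-! ### Variation over subsets of the plane

A finite ordered list `[x 0, ..., x n]` is given by `n` and a sequence `x`, of which only the terms
with index at most `n` matter. -/

/-- The curve variation of `f` on the list `[x 0, ..., x n]`. -/
noncomputable def cvar {σ : Set ℂ} (f : σ → ℂ) (n : ℕ) (x : ℕ → σ) : ℝ≥0∞ :=
  ∑ i ∈ Finset.range n, ‖f (x (i + 1)) - f (x i)‖ₑ

/-- The segment from `x i` to `x (i + 1)` is a crossing segment of the list on the line `ℓ`. -/
def IsCrossing (x : ℕ → ℂ) (ℓ : AffineSubspace ℝ ℂ) (i : ℕ) : Prop :=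
  ℓ.SOppSide (x i) (x (i + 1)) ∨ (i = 0 ∧ x i ∈ ℓ) ∨ (0 < i ∧ x i ∈ ℓ ∧ x (i - 1) ∉ ℓ)

open Classical in
/-- The number of crossing segments of the list `[x 0, ..., x n]` on the line `ℓ`. -/
noncomputable def vfLine (n : ℕ) (x : ℕ → ℂ) (ℓ : AffineSubspace ℝ ℂ) : ℕ :=
  ((Finset.range n).filter (IsCrossing x ℓ)).card

/-- The variation factor of the list `[x 0, ..., x n]`: the greatest number of crossing segments on
a line (the set below is nonempty and bounded by `n`). It is `1` for a one-point list. -/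
noncomputable def vf (n : ℕ) (x : ℕ → ℂ) : ℕ :=
  if n = 0 then 1
  else sSup {k | ∃ p q : ℂ, p ≠ q ∧ k = vfLine n x (line[ℝ, p, q])}

/-- The two-dimensional variation of `f : σ → ℂ`. -/
noncomputable def var {σ : Set ℂ} (f : σ → ℂ) : ℝ≥0∞ :=
  ⨆ (n : ℕ) (x : ℕ → σ), cvar f n x / (vf n (fun i => (x i : ℂ)) : ℝ≥0∞)

/-- The supremum norm, with values in `[0, ∞]`. -/
noncomputable def supNorm {σ : Set ℂ} (f : σ → ℂ) : ℝ≥0∞ := ⨆ z : σ, ‖f z‖ₑ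

/-- The variation norm, with values in `[0, ∞]`. -/
noncomputable def bvNorm {σ : Set ℂ} (f : σ → ℂ) : ℝ≥0∞ := supNorm f + var f

theorem vfLine_le (n : ℕ) (x : ℕ → ℂ) (ℓ : AffineSubspace ℝ ℂ) : vfLine n x ℓ ≤ n := by
  classical
  exact (Finset.card_filter_le _ _).trans (by simp)

theorem vfLine_le_vf {n : ℕ} (hn : n ≠ 0) (x : ℕ → ℂ) {p q : ℂ} (h : p ≠ q) :
    vfLine n x (line[ℝ, p, q]) ≤ vf n x := by
  rw [vf, if_neg hn]
  refine le_csSup ⟨n, ?_⟩ ⟨p, q, h, rfl⟩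
  rintro k ⟨p, q, -, rfl⟩
  exact vfLine_le _ _ _

theorem one_le_vf (n : ℕ) (x : ℕ → ℂ) : 1 ≤ vf n x := by
  classical
  rcases eq_or_ne n 0 with rfl | hn
  · simp [vf]
  · have h : x 0 ≠ x 0 + 1 := by simp
    refine le_trans ?_ (vfLine_le_vf hn x h)
    refine Finset.card_pos.2 ⟨0, ?_⟩
    simp only [Finset.mem_filter, Finset.mem_range]
    exact ⟨Nat.pos_of_ne_zero hn, Or.inr (Or.inl ⟨rfl, left_mem_affineSpan_pair ℝ _ _⟩)⟩

section
variable {σ : Set ℂ}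

theorem le_supNorm (f : σ → ℂ) (z : σ) : ‖f z‖ₑ ≤ supNorm f :=
  le_iSup (fun z : σ => ‖f z‖ₑ) z

theorem div_le_var (f : σ → ℂ) (n : ℕ) (x : ℕ → σ) :
    cvar f n x / (vf n (fun i => (x i : ℂ)) : ℝ≥0∞) ≤ var f :=
  le_iSup₂ (f := fun n x => cvar f n x / (vf n (fun i => ((x i : σ) : ℂ)) : ℝ≥0∞)) n x

theorem supNorm_le_bvNorm (f : σ → ℂ) : supNorm f ≤ bvNorm f := le_self_add

theorem bvNorm_const (c : ℂ) : bvNorm (fun _ : σ => c) ≤ ‖c‖ₑ := by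
  simp [bvNorm, supNorm, var, cvar, iSup_le_iff]

theorem bvNorm_zero : bvNorm (0 : σ → ℂ) = 0 := by
  exact le_antisymm ((bvNorm_const (σ := σ) 0).trans (by simp)) zero_le

theorem bvNorm_neg (f : σ → ℂ) : bvNorm (-f) = bvNorm f := by
  have h : ∀ a b : ℂ, ‖-a - -b‖ₑ = ‖a - b‖ₑ := fun a b => by
    rw [← enorm_neg]; congr 1; ring
  simp only [bvNorm, supNorm, var, cvar, Pi.neg_apply, h, enorm_neg]

theorem bvNorm_add_le (f g : σ → ℂ) : bvNorm (f + g) ≤ bvNorm f + bvNorm g := by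
  have h1 : supNorm (f + g) ≤ supNorm f + supNorm g :=
    iSup_le fun z => (enorm_add_le _ _).trans (add_le_add (le_supNorm f z) (le_supNorm g z))
  have h2 : var (f + g) ≤ var f + var g := by
    refine iSup₂_le fun n x => ?_
    refine le_trans ?_ (add_le_add (div_le_var f n x) (div_le_var g n x))
    rw [← ENNReal.add_div]
    refine ENNReal.div_le_div_right ?_ _
    rw [cvar, cvar, cvar, ← Finset.sum_add_distrib]
    refine Finset.sum_le_sum fun i _ => ?_
    refine le_trans (le_of_eq ?_) (enorm_add_le _ _)
    congr 1
    simp only [Pi.add_apply]; ring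
  calc bvNorm (f + g) ≤ (supNorm f + supNorm g) + (var f + var g) := add_le_add h1 h2
    _ = bvNorm f + bvNorm g := by rw [bvNorm, bvNorm]; ring

theorem bvNorm_mul_le (f g : σ → ℂ) : bvNorm (f * g) ≤ bvNorm f * bvNorm g := by
  have h1 : supNorm (f * g) ≤ supNorm f * supNorm g :=
    iSup_le fun z => by
      rw [Pi.mul_apply, enorm_mul]
      exact mul_le_mul' (le_supNorm f z) (le_supNorm g z)
  have h2 : var (f * g) ≤ supNorm f * var g + supNorm g * var f := by
    refine iSup₂_le fun n x => ?_
    refine le_trans ?_ (add_le_add (mul_le_mul_right (div_le_var g n x) _)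
      (mul_le_mul_right (div_le_var f n x) _))
    rw [← mul_div_assoc, ← mul_div_assoc, ← ENNReal.add_div]
    refine ENNReal.div_le_div_right ?_ _
    rw [cvar, cvar, cvar, Finset.mul_sum, Finset.mul_sum, ← Finset.sum_add_distrib]
    refine Finset.sum_le_sum fun i _ => ?_
    have e : (f * g) (x (i + 1)) - (f * g) (x i)
        = f (x (i + 1)) * (g (x (i + 1)) - g (x i)) + g (x i) * (f (x (i + 1)) - f (x i)) := by
      simp only [Pi.mul_apply]; ring
    rw [e]
    refine (enorm_add_le _ _).trans ?_
    rw [enorm_mul, enorm_mul]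
    exact add_le_add (mul_le_mul_left (le_supNorm f _) _)
      (mul_le_mul_left (le_supNorm g _) _)
  calc bvNorm (f * g) ≤ supNorm f * supNorm g + (supNorm f * var g + supNorm g * var f) :=
        add_le_add h1 h2
    _ ≤ supNorm f * supNorm g + (supNorm f * var g + supNorm g * var f) + var f * var g :=
        le_self_add
    _ = bvNorm f * bvNorm g := by rw [bvNorm, bvNorm]; ring

/-- Lower semicontinuity of the variation norm under pointwise limits. -/
theorem bvNorm_le_of_tendsto {u : ℕ → σ → ℂ} {f : σ → ℂ}
    (hu : ∀ z, Filter.Tendsto (fun k => u k z) Filter.atTop (nhds (f z))) {C : ℝ≥0∞}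
    (hC : ∀ᶠ k in Filter.atTop, bvNorm (u k) ≤ C) : bvNorm f ≤ C := by
  have key : ∀ (z : σ) (n : ℕ) (x : ℕ → σ),
      ‖f z‖ₑ + cvar f n x / (vf n (fun i => (x i : ℂ)) : ℝ≥0∞) ≤ C := by
    intro z n x
    have hv : (vf n (fun i => (x i : ℂ)) : ℝ≥0∞) ≠ 0 := by
      have := one_le_vf n (fun i => (x i : ℂ))
      exact_mod_cast (by omega : vf n (fun i => (x i : ℂ)) ≠ 0)
    have t1 : Filter.Tendsto (fun k => cvar (u k) n x) Filter.atTop (nhds (cvar f n x)) :=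
      tendsto_finsetSum _ fun i _ => ((hu _).sub (hu _)).enorm
    have t2 := ((hu z).enorm).add (ENNReal.Tendsto.div_const t1 (Or.inr hv))
    refine le_of_tendsto t2 (hC.mono fun k hk => le_trans ?_ hk)
    exact add_le_add (le_supNorm _ z) (div_le_var _ n x)
  rcases isEmpty_or_nonempty σ with h | ⟨⟨z0⟩⟩
  · have : f = 0 := funext fun z => (h.false z).elim
    rw [this, bvNorm_zero]; exact zero_le
  · have : Nonempty σ := ⟨z0⟩
    rw [bvNorm, supNorm, ENNReal.iSup_add]
    refine iSup_le fun z => ?_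
    rw [var]
    simp only [ENNReal.add_iSup]
    exact iSup_le fun n => iSup_le fun x => key z n x

end

/-- The functions of bounded variation on `σ`, as a subalgebra of all functions `σ → ℂ` with
pointwise operations. -/
def bvSubalgebra (σ : Set ℂ) : Subalgebra ℂ (σ → ℂ) where
  carrier := {f | bvNorm f < ⊤}
  mul_mem' {f g} hf hg := (bvNorm_mul_le f g).trans_lt (ENNReal.mul_lt_top hf hg)
  add_mem' {f g} hf hg := (bvNorm_add_le f g).trans_lt (ENNReal.add_lt_top.2 ⟨hf, hg⟩)
  algebraMap_mem' c := (bvNorm_const c).trans_lt enorm_lt_top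

/-- The algebra `BV(σ)`. It is a type synonym, so that its topology is the one of the variation
norm (below) and not the topology of pointwise convergence. -/
def BV (σ : Set ℂ) : Type := bvSubalgebra σ

namespace BV
variable {σ : Set ℂ}

noncomputable instance : CommRing (BV σ) := inferInstanceAs (CommRing (bvSubalgebra σ))

noncomputable instance : Algebra ℂ (BV σ) := inferInstanceAs (Algebra ℂ (bvSubalgebra σ))

instance : FunLike (BV σ) σ ℂ where
  coe f := f.1
  coe_injective _ _ h := Subtype.ext h

theorem bvNorm_lt_top (f : BV σ) : bvNorm (f : σ → ℂ) < ⊤ := f.2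

theorem coe_add (f g : BV σ) : ⇑(f + g) = f + g := rfl
theorem coe_sub (f g : BV σ) : ⇑(f - g) = f - g := rfl
theorem coe_neg (f : BV σ) : ⇑(-f) = -f := rfl
theorem coe_zero : ⇑(0 : BV σ) = 0 := rfl
theorem coe_one : ⇑(1 : BV σ) = 1 := rfl
theorem coe_mul (f g : BV σ) : ⇑(f * g) = f * g := rfl
theorem coe_smul (c : ℂ) (f : BV σ) : ⇑(c • f) = c • ⇑f := rfl

noncomputable instance : Norm (BV σ) := ⟨fun f => (bvNorm (f : σ → ℂ)).toReal⟩

theorem norm_def (f : BV σ) : ‖f‖ = (bvNorm (f : σ → ℂ)).toReal := rfl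

/-- `BV(σ)` is a normed ring under the variation norm. -/
noncomputable instance : NormedCommRing (BV σ) where
  toCommRing := inferInstance
  toNorm := inferInstance
  toMetricSpace := (AddGroupNorm.toNormedAddCommGroup
    { toFun := fun f : BV σ => ‖f‖
      map_zero' := by rw [norm_def, coe_zero, bvNorm_zero]; rfl
      add_le' := fun f g => by
        rw [norm_def, norm_def, norm_def, coe_add,
          ← ENNReal.toReal_add (bvNorm_lt_top f).ne (bvNorm_lt_top g).ne]
        exact ENNReal.toReal_mono
          (ENNReal.add_lt_top.2 ⟨bvNorm_lt_top f, bvNorm_lt_top g⟩).ne (bvNorm_add_le _ _)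
      neg' := fun f => by rw [norm_def, norm_def, coe_neg, bvNorm_neg]
      eq_zero_of_map_eq_zero' := fun f hf => by
        have h0 : bvNorm (f : σ → ℂ) = 0 := by
          rcases (ENNReal.toReal_eq_zero_iff _).1 hf with h | h
          · exact h
          · exact absurd h (bvNorm_lt_top f).ne
        refine DFunLike.coe_injective (funext fun z => ?_)
        have : ‖f z‖ₑ ≤ 0 := h0 ▸ (le_supNorm _ z).trans (supNorm_le_bvNorm _)
        simpa [coe_zero] using this }).toMetricSpace
  dist_eq _ _ := rfl
  norm_mul_le f g := by
    rw [norm_def, norm_def, norm_def, coe_mul, ← ENNReal.toReal_mul]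
    exact ENNReal.toReal_mono
      (ENNReal.mul_lt_top (bvNorm_lt_top f) (bvNorm_lt_top g)).ne (bvNorm_mul_le _ _)

noncomputable instance : NormedAlgebra ℂ (BV σ) where
  norm_smul_le c f := by
    have e : ⇑(c • f) = (fun _ => c) * ⇑f := rfl
    rw [norm_def, norm_def, e, ← toReal_enorm c, ← ENNReal.toReal_mul]
    refine ENNReal.toReal_mono (ENNReal.mul_lt_top enorm_lt_top (bvNorm_lt_top f)).ne ?_
    exact (bvNorm_mul_le _ _).trans (mul_le_mul_left (bvNorm_const c) _)

/-- `BV(σ)` is complete, hence a Banach algebra. -/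
instance : CompleteSpace (BV σ) := by
  refine Metric.complete_of_cauchySeq_tendsto fun u hu => ?_
  have hdist : ∀ f g : BV σ, bvNorm (⇑f - ⇑g) = ENNReal.ofReal (dist f g) := fun f g => by
    rw [dist_eq_norm, norm_def, coe_sub,
      ENNReal.ofReal_toReal (by rw [← coe_sub]; exact (bvNorm_lt_top _).ne)]
  have hpt : ∀ z, CauchySeq fun k => u k z := fun z => by
    rw [Metric.cauchySeq_iff] at hu ⊢
    intro ε hε
    obtain ⟨N, hN⟩ := hu ε hε
    refine ⟨N, fun m hm n hn => lt_of_le_of_lt ?_ (hN m hm n hn)⟩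
    have h1 : ‖u m z - u n z‖ₑ ≤ ENNReal.ofReal (dist (u m) (u n)) := by
      rw [← hdist]
      exact (le_supNorm (⇑(u m) - ⇑(u n)) z).trans (supNorm_le_bvNorm _)
    rw [← ofReal_norm, ENNReal.ofReal_le_ofReal_iff dist_nonneg] at h1
    rwa [dist_eq_norm]
  choose f hf using fun z => cauchySeq_tendsto_of_complete (hpt z)
  have hlim : ∀ ε > 0, ∃ N, ∀ m ≥ N, bvNorm (⇑(u m) - f) ≤ ENNReal.ofReal ε := by
    intro ε hε
    obtain ⟨N, hN⟩ := Metric.cauchySeq_iff.1 hu ε hε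
    refine ⟨N, fun m hm => ?_⟩
    refine bvNorm_le_of_tendsto (u := fun k => ⇑(u m) - ⇑(u k))
      (fun z => tendsto_const_nhds.sub (hf z)) ?_
    filter_upwards [Filter.eventually_ge_atTop N] with k hk
    rw [hdist]
    exact ENNReal.ofReal_le_ofReal (hN m hm k hk).le
  have hfin : bvNorm f < ⊤ := by
    obtain ⟨N, hN⟩ := hlim 1 one_pos
    have e : f = ⇑(u N) + -(⇑(u N) - f) := by simp
    rw [e]
    refine (bvNorm_add_le _ _).trans_lt (ENNReal.add_lt_top.2 ⟨bvNorm_lt_top _, ?_⟩)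
    rw [bvNorm_neg]
    exact (hN N le_rfl).trans_lt ENNReal.ofReal_lt_top
  refine ⟨(⟨f, hfin⟩ : bvSubalgebra σ), Metric.tendsto_atTop.2 fun ε hε => ?_⟩
  obtain ⟨N, hN⟩ := hlim (ε / 2) (half_pos hε)
  refine ⟨N, fun m hm => ?_⟩
  have h1 := (hdist (u m) (⟨f, hfin⟩ : bvSubalgebra σ)).symm.le.trans (hN m hm)
  rw [ENNReal.ofReal_le_ofReal_iff (half_pos hε).le] at h1
  exact h1.trans_lt (half_lt_self hε)

end BV

/-! ### Linear graphs -/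

/-- The class `LG`: compact connected (in particular nonempty) subsets of the plane that are the
union of finitely many compact line segments. -/
def IsLG (σ : Set ℂ) : Prop :=
  IsCompact σ ∧ IsConnected σ ∧
    ∃ S : Finset (ℂ × ℂ), σ = ⋃ e ∈ S, segment ℝ e.1 e.2

/-- A proper representation of `σ` as a union of `m` line segments: distinct segments meet only in
common endpoints. The segments are non-degenerate, unless `σ` is a single point. -/
structure ProperRep (σ : Set ℂ) (m : ℕ) where
  left : Fin m → ℂ
  right : Fin m → ℂ
  left_ne_right : σ.Nontrivial → ∀ k, left k ≠ right k
  union_eq : (⋃ k, segment ℝ (left k) (right k)) = σ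
  inter_subset : ∀ j k, j ≠ k →
    segment ℝ (left j) (right j) ∩ segment ℝ (left k) (right k) ⊆
      {left j, right j} ∩ {left k, right k}

namespace ProperRep
variable {σ : Set ℂ} {m : ℕ}

/-- The `k`-th segment of a proper representation. -/
def seg (r : ProperRep σ m) (k : Fin m) : Set ℂ := segment ℝ (r.left k) (r.right k)

theorem seg_subset (r : ProperRep σ m) (k : Fin m) : r.seg k ⊆ σ := by
  intro z hz
  rw [← r.union_eq]
  exact Set.mem_iUnion.2 ⟨k, hz⟩

/-- The `LG` norm of `f`, computed from the proper representation `r`, with values in `[0, ∞]`: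
the supremum norm of `f` plus the variations of the restrictions of `f` to the segments. -/
noncomputable def lgNorm (r : ProperRep σ m) (f : σ → ℂ) : ℝ≥0∞ :=
  supNorm f + ∑ k, var (f ∘ Set.inclusion (r.seg_subset k))

end ProperRep

/-- `φ : σ ≃ₜ τ` maps the segments of the representation `r` of `σ` affinely onto the corresponding
segments of the representation `q` of `τ`. -/
def IsSegmentwiseAffine {σ τ : Set ℂ} {m : ℕ} (r : ProperRep σ m) (q : ProperRep τ m)
    (φ : σ ≃ₜ τ) : Prop :=
  ∀ k, ∃ A : ℂ →ᵃ[ℝ] ℂ, (∀ z : σ, (z : ℂ) ∈ r.seg k → (φ z : ℂ) = A z) ∧ A '' r.seg k = q.seg k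

end PlaneBV

namespace PlaneBV

/-! ### Variation over families of intervals -/

/-! The `BV` norm of a linear graph is equivalent to the `LG` norm, which sees only one segment at a
time. Along one segment the planar variation is the ordinary variation of the parametrized function
(`var_segment`). Indeed, every step that passes over the parameter `c` crosses the perpendicular at
`c`, so apart from the parameters of the list itself no point is covered by more than `vf` steps;
conversely, monotone lists have variation factor one. On a union of `m` segments each step stays in
a segment or leaves one. A segment is cut out by three lines, so the departures from it number at
most a constant times `vf`, and each costs at most twice the supremum (`var_le_sum_segments`). Hence
the norms are equivalent with constants depending only on `m`.

The `LG` norm depends only on the values of `f` along parametrizations, so a homeomorphism matching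
parametrizations preserves it, and composition with it is bounded on `BV` in both directions.
Independence of the representation follows by intersecting the segments of two representations
(`ProperRep.lgNorm_eq`).

The given homeomorphism `h` need not be affine anywhere. Take a finite set `W` in `σ` that contains
the subdivision points of `σ` and the preimages of those of `τ`. Outside `W` and `h '' W` the graphs
consist of open straight edges (`exists_subdivision`). Such an edge is open, connected, disjoint
from the vertices, and has its endpoints as boundary; these are topological properties, so `h`
carries edges to edges (`IsEdge.image`). Replacing `h` on every edge by the affine map with the same
endpoint values gives `φ`. -/

theorem eVariationOn_Icc_inter_add (g : ℝ → ℂ) (l r : ℝ) {a b c : ℝ} (hac : a ≤ c) (hcb : c ≤ b) :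
    eVariationOn g (Set.Icc l r ∩ Set.Icc a c) + eVariationOn g (Set.Icc l r ∩ Set.Icc c b)
      = eVariationOn g (Set.Icc l r ∩ Set.Icc a b) := by
  by_cases hc : c ∈ Set.Icc l r
  · exact eVariationOn.Icc_add_Icc g hac hcb hc
  · rw [Set.mem_Icc, not_and_or, not_le, not_le] at hc
    rcases hc with hc | hc
    · have h1 : Set.Icc l r ∩ Set.Icc a c = ∅ := by
        ext t; simp only [Set.mem_inter_iff, Set.mem_Icc, Set.mem_empty_iff_false, iff_false]
        rintro ⟨⟨h1, -⟩, -, h2⟩; linarith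
      have h2 : Set.Icc l r ∩ Set.Icc c b = Set.Icc l r ∩ Set.Icc a b := by
        ext t; simp only [Set.mem_inter_iff, Set.mem_Icc]
        constructor
        · rintro ⟨⟨h1, h2⟩, h3, h4⟩; exact ⟨⟨h1, h2⟩, by linarith, h4⟩
        · rintro ⟨⟨h1, h2⟩, h3, h4⟩; exact ⟨⟨h1, h2⟩, by linarith, h4⟩
      rw [h1, h2, eVariationOn.subsingleton g Set.subsingleton_empty, zero_add]
    · have h1 : Set.Icc l r ∩ Set.Icc c b = ∅ := by
        ext t; simp only [Set.mem_inter_iff, Set.mem_Icc, Set.mem_empty_iff_false, iff_false]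
        rintro ⟨⟨-, h1⟩, h2, -⟩; linarith
      have h2 : Set.Icc l r ∩ Set.Icc a c = Set.Icc l r ∩ Set.Icc a b := by
        ext t; simp only [Set.mem_inter_iff, Set.mem_Icc]
        constructor
        · rintro ⟨⟨h1, h2⟩, h3, h4⟩; exact ⟨⟨h1, h2⟩, h3, by linarith⟩
        · rintro ⟨⟨h1, h2⟩, h3, h4⟩; exact ⟨⟨h1, h2⟩, h3, by linarith⟩
      rw [h1, h2, eVariationOn.subsingleton g Set.subsingleton_empty, add_zero]

-- An interval without endpoints in `(a, b)` either contains `[a, b]` or meets it in at most one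
-- point, and a single interior point `c` decides which.
open Classical in
theorem eVariationOn_Icc_inter_of_no_endpoint (g : ℝ → ℂ) {l r a b c : ℝ} (hc : c ∈ Set.Ioo a b)
    (hl : l ∉ Set.Ioo a b) (hr : r ∉ Set.Ioo a b) :
    eVariationOn g (Set.Icc l r ∩ Set.Icc a b)
      = if c ∈ Set.Icc l r then eVariationOn g (Set.Icc a b) else 0 := by
  simp only [Set.mem_Ioo, not_and_or, not_lt] at hl hr
  obtain ⟨hac, hcb⟩ := hc
  split_ifs with h
  · congr 1
    refine Set.inter_eq_right.2 (Set.Icc_subset_Icc ?_ ?_)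
    · rcases hl with hl | hl
      · exact hl
      · linarith [h.1]
    · rcases hr with hr | hr
      · linarith [h.2]
      · exact hr
  · refine eVariationOn.subsingleton g fun s hs t ht => ?_
    rw [Set.mem_Icc, not_and_or, not_le, not_le] at h
    obtain ⟨⟨hs1, hs2⟩, hs3, hs4⟩ := hs
    obtain ⟨⟨ht1, ht2⟩, ht3, ht4⟩ := ht
    rcases h with h | h
    · rcases hl with hl | hl <;> linarith
    · rcases hr with hr | hr <;> linarith

-- Induction on a finite set `P` containing all endpoints inside `(a, b)`. A point of `P` cuts `[a,
-- b]` in two and both sums are additive under the cut. Once no endpoint is left, each interval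
-- contributes everything or nothing, so the sums are multiples of one variation and the covering
-- numbers at a single point compare them.
open Classical in
theorem sum_eVariationOn_inter_le_aux {ι κ : Type*} (g : ℝ → ℂ) (J : Finset ι) (K : Finset κ)
    (l r : ι → ℝ) (l' r' : κ → ℝ) (P : Finset ℝ) : ∀ a b : ℝ, a < b →
    (∀ i ∈ J, (l i ∈ Set.Ioo a b → l i ∈ P) ∧ (r i ∈ Set.Ioo a b → r i ∈ P)) →
    (∀ i ∈ K, (l' i ∈ Set.Ioo a b → l' i ∈ P) ∧ (r' i ∈ Set.Ioo a b → r' i ∈ P)) →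
    (∀ c ∈ Set.Ioo a b, c ∉ P → (J.filter fun i => c ∈ Set.Icc (l i) (r i)).card
      ≤ (K.filter fun i => c ∈ Set.Icc (l' i) (r' i)).card) →
    ∑ i ∈ J, eVariationOn g (Set.Icc (l i) (r i) ∩ Set.Icc a b)
      ≤ ∑ i ∈ K, eVariationOn g (Set.Icc (l' i) (r' i) ∩ Set.Icc a b) := by
  induction P using Finset.induction with
  | empty =>
    intro a b hab hJ hK hcard
    obtain ⟨c, hc⟩ : (Set.Ioo a b).Nonempty := Set.nonempty_Ioo.2 hab
    rw [Finset.sum_congr rfl fun i hi => eVariationOn_Icc_inter_of_no_endpoint g hc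
        (fun h => by simpa using (hJ i hi).1 h) (fun h => by simpa using (hJ i hi).2 h),
      Finset.sum_congr rfl fun i hi => eVariationOn_Icc_inter_of_no_endpoint g hc
        (fun h => by simpa using (hK i hi).1 h) (fun h => by simpa using (hK i hi).2 h),
      ← Finset.sum_filter, ← Finset.sum_filter, Finset.sum_const, Finset.sum_const]
    exact nsmul_le_nsmul_left zero_le (hcard c hc (by simp))
  | insert c P hcP ih =>
    intro a b hab hJ hK hcard
    by_cases hc : c ∈ Set.Ioo a b
    · have key : ∀ a' b' : ℝ, a' < b' → a ≤ a' → b' ≤ b → c ∉ Set.Ioo a' b' →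
          ∑ i ∈ J, eVariationOn g (Set.Icc (l i) (r i) ∩ Set.Icc a' b')
            ≤ ∑ i ∈ K, eVariationOn g (Set.Icc (l' i) (r' i) ∩ Set.Icc a' b') := by
        intro a' b' h1 h2 h3 h4
        have hsub : Set.Ioo a' b' ⊆ Set.Ioo a b := Set.Ioo_subset_Ioo h2 h3
        have hne : ∀ p ∈ Set.Ioo a' b', p ∈ insert c P → p ∈ P := fun p hp hp' => by
          rcases Finset.mem_insert.1 hp' with rfl | h
          · exact absurd hp h4
          · exact h
        refine ih a' b' h1
          (fun i hi => ⟨fun h => hne _ h ((hJ i hi).1 (hsub h)),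
            fun h => hne _ h ((hJ i hi).2 (hsub h))⟩)
          (fun i hi => ⟨fun h => hne _ h ((hK i hi).1 (hsub h)),
            fun h => hne _ h ((hK i hi).2 (hsub h))⟩)
          (fun d hd hdP => hcard d (hsub hd) fun h => hdP (hne d hd h))
      have h1 := key a c hc.1 le_rfl hc.2.le (fun h => lt_irrefl _ h.2)
      have h2 := key c b hc.2 hc.1.le le_rfl (fun h => lt_irrefl _ h.1)
      simp only [← eVariationOn_Icc_inter_add g _ _ hc.1.le hc.2.le, Finset.sum_add_distrib]
      exact add_le_add h1 h2
    · have hne : ∀ p ∈ Set.Ioo a b, p ∈ insert c P → p ∈ P := fun p hp hp' => by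
        rcases Finset.mem_insert.1 hp' with rfl | h
        · exact absurd hp hc
        · exact h
      exact ih a b hab
          (fun i hi => ⟨fun h => hne _ h ((hJ i hi).1 h), fun h => hne _ h ((hJ i hi).2 h)⟩)
          (fun i hi => ⟨fun h => hne _ h ((hK i hi).1 h), fun h => hne _ h ((hK i hi).2 h)⟩)
          (fun d hd hdP => hcard d hd fun h => hdP (hne d hd h))

open Classical in
/-- If almost every point of `[a, b]` is covered by at most as many intervals of the first family
as of the second, then the variations over the first family have the smaller sum. -/
theorem sum_eVariationOn_inter_le {ι κ : Type*} (g : ℝ → ℂ) (J : Finset ι) (K : Finset κ)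
    (l r : ι → ℝ) (l' r' : κ → ℝ) {a b : ℝ} (hab : a < b)
    (h : ∀ c ∈ Set.Ioo a b, (∀ i ∈ J, c ≠ l i ∧ c ≠ r i) → (∀ i ∈ K, c ≠ l' i ∧ c ≠ r' i) →
      (J.filter fun i => c ∈ Set.Icc (l i) (r i)).card
        ≤ (K.filter fun i => c ∈ Set.Icc (l' i) (r' i)).card) :
    ∑ i ∈ J, eVariationOn g (Set.Icc (l i) (r i) ∩ Set.Icc a b)
      ≤ ∑ i ∈ K, eVariationOn g (Set.Icc (l' i) (r' i) ∩ Set.Icc a b) := by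
  refine sum_eVariationOn_inter_le_aux g J K l r l' r'
    ((J.image l ∪ J.image r) ∪ (K.image l' ∪ K.image r')) a b hab ?_ ?_ ?_
  · exact fun i hi => ⟨fun _ => by simp only [Finset.mem_union, Finset.mem_image]; grind,
      fun _ => by simp only [Finset.mem_union, Finset.mem_image]; grind⟩
  · exact fun i hi => ⟨fun _ => by simp only [Finset.mem_union, Finset.mem_image]; grind,
      fun _ => by simp only [Finset.mem_union, Finset.mem_image]; grind⟩
  · intro c hc hcP
    simp only [Finset.mem_union, Finset.mem_image, not_or, not_exists, not_and] at hcP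
    exact h c hc (fun i hi => ⟨fun e => hcP.1.1 i hi e.symm, fun e => hcP.1.2 i hi e.symm⟩)
      (fun i hi => ⟨fun e => hcP.2.1 i hi e.symm, fun e => hcP.2.2 i hi e.symm⟩)

/-! ### Lines and crossing segments -/

/-- A real affine function that vanishes on the line through `p` orthogonal to `d`. -/
noncomputable def lineFun (p d z : ℂ) : ℝ := (z.re - p.re) * d.re + (z.im - p.im) * d.im

theorem lineFun_lineMap (p d a b : ℂ) (t : ℝ) :
    lineFun p d (AffineMap.lineMap a b t) = (1 - t) * lineFun p d a + t * lineFun p d b := by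
  simp [lineFun, AffineMap.lineMap_apply]; ring

theorem mem_line_iff {p d z : ℂ} (hd : d ≠ 0) :
    z ∈ line[ℝ, p, p + Complex.I * d] ↔ lineFun p d z = 0 := by
  have hd2 : d.re * d.re + d.im * d.im ≠ 0 := by
    have := Complex.normSq_pos.2 hd
    rw [Complex.normSq_apply] at this; exact this.ne'
  rw [mem_affineSpan_pair_iff_exists_lineMap_eq]
  constructor
  · rintro ⟨t, rfl⟩
    simp [lineFun, AffineMap.lineMap_apply]; ring
  · intro h
    -- `t` is the coordinate of `z - p` along `Complex.I * d`, the direction of the line.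
    obtain ⟨t, ht⟩ : ∃ t : ℝ, t * (d.re * d.re + d.im * d.im)
        = (z.im - p.im) * d.re - (z.re - p.re) * d.im := ⟨_, div_mul_cancel₀ _ hd2⟩
    unfold lineFun at h
    refine ⟨t, Complex.ext (mul_left_cancel₀ hd2 ?_) (mul_left_cancel₀ hd2 ?_)⟩
    · simp [AffineMap.lineMap_apply, -mul_eq_mul_left_iff]
      linear_combination (-d.im) * ht - d.re * h
    · simp [AffineMap.lineMap_apply, -mul_eq_mul_left_iff]
      linear_combination d.re * ht - d.im * h

theorem sOppSide_iff {p d x y : ℂ} (hd : d ≠ 0) :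
    (line[ℝ, p, p + Complex.I * d]).SOppSide x y ↔ lineFun p d x * lineFun p d y < 0 := by
  unfold AffineSubspace.SOppSide
  rw [AffineSubspace.wOppSide_iff_exists_wbtw, mem_line_iff hd, mem_line_iff hd]
  constructor
  · rintro ⟨⟨w, hw, t, ⟨ht0, ht1⟩, rfl⟩, hx, hy⟩
    rw [mem_line_iff hd, lineFun_lineMap] at hw
    have h0 : 0 < t := by
      rcases ht0.eq_or_lt with rfl | h
      · simp at hw; exact absurd hw hx
      · exact h
    rcases lt_or_gt_of_ne hx with h | h <;> rcases lt_or_gt_of_ne hy with h' | h'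
    · nlinarith
    · nlinarith
    · nlinarith
    · nlinarith
  · intro h
    have hx : lineFun p d x ≠ 0 := by rintro e; simp [e] at h
    have hy : lineFun p d y ≠ 0 := by rintro e; simp [e] at h
    refine ⟨?_, hx, hy⟩
    set u := lineFun p d x
    set v := lineFun p d y
    have huv : u - v ≠ 0 := by
      intro e
      rw [sub_eq_zero.1 e] at h
      nlinarith [mul_self_nonneg v]
    have h2 : u * (u - v) > 0 := by nlinarith [sq_nonneg u]
    have h3 : (u - v) * (u - v) > 0 := mul_self_pos.2 huv
    have e : u / (u - v) = u * (u - v) / ((u - v) * (u - v)) := by field_simp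
    -- The parameter `u / (u - v)` is the zero of `(1 - t) * u + t * v`.
    refine ⟨AffineMap.lineMap x y (u / (u - v)), ?_, u / (u - v), ⟨?_, ?_⟩, rfl⟩
    · rw [mem_line_iff hd, lineFun_lineMap]; change _ * u + _ * v = 0; field_simp; ring
    · rw [e]; positivity
    · rw [e, div_le_one h3]; nlinarith [sq_nonneg v]

theorem exists_line_eq {p q : ℂ} (h : p ≠ q) :
    ∃ d : ℂ, d ≠ 0 ∧ line[ℝ, p, q] = line[ℝ, p, p + Complex.I * d] := by
  refine ⟨-Complex.I * (q - p), mul_ne_zero (by simp) (sub_ne_zero.2 h.symm), ?_⟩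
  rw [← mul_assoc]; simp

/-- `IsCrossing` in terms of the values of a function that defines the line. -/
def SignCrossing (g : ℕ → ℝ) (i : ℕ) : Prop :=
  g i * g (i + 1) < 0 ∨ (i = 0 ∧ g i = 0) ∨ (0 < i ∧ g i = 0 ∧ g (i - 1) ≠ 0)

theorem isCrossing_iff {p d : ℂ} (hd : d ≠ 0) (x : ℕ → ℂ) (i : ℕ) :
    IsCrossing x (line[ℝ, p, p + Complex.I * d]) i
      ↔ SignCrossing (fun i => lineFun p d (x i)) i := by
  rw [IsCrossing, SignCrossing, sOppSide_iff hd, mem_line_iff hd, mem_line_iff hd]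

open Classical in
theorem card_signCrossing_le_vf {p d : ℂ} (hd : d ≠ 0) (x : ℕ → ℂ) {n : ℕ} (hn : n ≠ 0) :
    ((Finset.range n).filter (SignCrossing fun i => lineFun p d (x i))).card ≤ vf n x := by
  have := vfLine_le_vf hn x (p := p) (q := p + Complex.I * d) (by simpa using hd)
  rw [vfLine] at this
  convert this using 5
  exact (isCrossing_iff hd x _).symm

-- A strict sign change is itself a crossing. A run of zeros can produce two sign changes, on entry
-- and on exit, but only one crossing, recorded at its first index. A list ending in the first zero
-- of a run has paid for the entry without having the crossing yet, hence the `+ 1`; one ending in a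
-- longer run of zeros has the crossing and a change to spare. The three cases form one induction
-- hypothesis.
open Classical in
theorem card_sign_ne_le (g : ℕ → ℝ) (n : ℕ) :
    (g n ≠ 0 → ((Finset.range n).filter fun i => SignType.sign (g i) ≠ SignType.sign (g (i + 1))).card
      ≤ 2 * ((Finset.range n).filter (SignCrossing g)).card) ∧
    ((Finset.range n).filter fun i => SignType.sign (g i) ≠ SignType.sign (g (i + 1))).card
      ≤ 2 * ((Finset.range n).filter (SignCrossing g)).card + 1 ∧
    (g n = 0 → 0 < n → g (n - 1) = 0 →
      ((Finset.range n).filter fun i => SignType.sign (g i) ≠ SignType.sign (g (i + 1))).card + 1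
      ≤ 2 * ((Finset.range n).filter (SignCrossing g)).card) := by
  induction n with
  | zero => simp
  | succ n ih =>
    obtain ⟨h1, h2, h3⟩ := ih
    rw [Finset.range_add_one, Finset.filter_insert, Finset.filter_insert]
    by_cases hn : g n = 0
    · by_cases hc : SignCrossing g n
      · rw [if_pos hc, Finset.card_insert_of_notMem (by simp)]
        have h0 : n = 0 → ((Finset.range n).filter fun i =>
          SignType.sign (g i) ≠ SignType.sign (g (i + 1))).card = 0 := by rintro rfl; simp
        split_ifs with hs
        · rw [Finset.card_insert_of_notMem (by simp)]
          refine ⟨fun _ => by omega, by omega, fun h => ?_⟩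
          simp [hn, h] at hs
        · refine ⟨fun _ => by omega, by omega, fun h _ _ => by omega⟩
      · have hn0 : 0 < n := by
          by_contra h
          exact hc (Or.inr (Or.inl ⟨by omega, hn⟩))
        have hp : g (n - 1) = 0 := by
          by_contra h
          exact hc (Or.inr (Or.inr ⟨hn0, hn, h⟩))
        have := h3 hn hn0 hp
        rw [if_neg hc]
        split_ifs with hs
        · rw [Finset.card_insert_of_notMem (by simp)]
          refine ⟨fun _ => by omega, by omega, fun h => ?_⟩
          simp [hn, h] at hs
        · refine ⟨fun _ => by omega, by omega, fun h _ _ => by omega⟩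
    · have := h1 hn
      have hcr : g (n + 1) ≠ 0 → SignType.sign (g n) ≠ SignType.sign (g (n + 1)) →
          SignCrossing g n := by
        intro h h'
        left
        rcases lt_or_gt_of_ne hn with a | a <;> rcases lt_or_gt_of_ne h with b | b
        · simp [sign_neg, a, b] at h'
        · exact mul_neg_of_neg_of_pos a b
        · exact mul_neg_of_pos_of_neg a b
        · simp [sign_pos, a, b] at h'
      by_cases hc : SignCrossing g n
      · rw [if_pos hc, Finset.card_insert_of_notMem (by simp)]
        split_ifs with hs
        · rw [Finset.card_insert_of_notMem (by simp)]
          exact ⟨fun _ => by omega, by omega, fun _ _ h => absurd h hn⟩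
        · exact ⟨fun _ => by omega, by omega, fun _ _ h => absurd h hn⟩
      · rw [if_neg hc]
        split_ifs with hs
        · rw [Finset.card_insert_of_notMem (by simp)]
          exact ⟨fun h => absurd (hcr h hs) hc, by omega, fun _ _ h => absurd h hn⟩
        · exact ⟨fun _ => by omega, by omega, fun _ _ h => absurd h hn⟩

open Classical in
/-- The number of steps of a list that change their position relative to a line is controlled by
the variation factor. -/
theorem card_sign_ne_le_vf {p d : ℂ} (hd : d ≠ 0) (x : ℕ → ℂ) (n : ℕ) :
    ((Finset.range n).filter fun i => SignType.sign (lineFun p d (x i))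
      ≠ SignType.sign (lineFun p d (x (i + 1)))).card ≤ 3 * vf n x := by
  rcases eq_or_ne n 0 with rfl | hn
  · simp
  · have h1 := (card_sign_ne_le (fun i => lineFun p d (x i)) n).2.1
    have h2 := card_signCrossing_le_vf (p := p) hd x hn
    -- This absorbs the `+ 1` into a third multiple of `vf`.
    have h3 := one_le_vf n x
    omega

theorem SignCrossing.neg {g : ℕ → ℝ} {i : ℕ} (h : SignCrossing g i) :
    SignCrossing (fun i => -g i) i := by
  simpa [SignCrossing] using h

/-- The later crossing forces `g i < 0` and `g j ≤ 0`. Then the crossing at `i` is a strict change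
of sign, so `g (i + 1) > 0`, against `g (i + 1) ≤ g j`. -/
theorem not_signCrossing_of_lt_of_monotone {g : ℕ → ℝ} (hg : Monotone g) {i j : ℕ} (hij : i < j)
    (hi : SignCrossing g i) (hj : SignCrossing g j) : False := by
  have h1 : g i ≤ g (i + 1) := hg (by omega)
  have h2 : g (i + 1) ≤ g j := hg (by omega)
  have h3 : g j ≤ g (j + 1) := hg (by omega)
  have h4 : g i ≤ g (j - 1) := hg (by omega)
  have h5 : g (j - 1) ≤ g j := hg (by omega)
  have hi0 : g i < 0 := by
    rcases hj with hj | hj | hj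
    · rcases mul_neg_iff.1 hj with h | h <;> linarith
    · omega
    · have := lt_of_le_of_ne (hj.2.1 ▸ h5) hj.2.2; linarith
  have hj0 : g j ≤ 0 := by
    rcases hj with hj | hj | hj
    · rcases mul_neg_iff.1 hj with h | h <;> linarith
    · omega
    · exact hj.2.1.le
  rcases hi with hi | hi | hi
  · rcases mul_neg_iff.1 hi with h | h <;> linarith
  · linarith [hi.2]
  · linarith [hi.2.1]

/-- The defining function of any line is affine along the segment, hence monotone up to sign along
the list, and a monotone sequence crosses zero at most once. -/
theorem vf_lineMap_le_one (a b : ℂ) {u : ℕ → ℝ} (hu : Monotone u) (n : ℕ) :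
    vf n (fun i => AffineMap.lineMap a b (u i)) ≤ 1 := by
  classical
  rcases eq_or_ne n 0 with rfl | hn
  · simp [vf]
  rw [vf, if_neg hn]
  refine csSup_le ⟨_, 0, 1, zero_ne_one, rfl⟩ ?_
  rintro k ⟨p, q, hpq, rfl⟩
  obtain ⟨d, hd, e⟩ := exists_line_eq hpq
  rw [vfLine, e]
  have hmono : ∀ i j, i < j → IsCrossing (fun i => AffineMap.lineMap a b (u i))
      (line[ℝ, p, p + Complex.I * d]) i → ¬ IsCrossing (fun i => AffineMap.lineMap a b (u i))
      (line[ℝ, p, p + Complex.I * d]) j := by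
    intro i j hij hi hj
    rw [isCrossing_iff hd] at hi hj
    simp only [lineFun_lineMap] at hi hj
    rcases le_total (lineFun p d a) (lineFun p d b) with h | h
    · refine not_signCrossing_of_lt_of_monotone (fun i j hij => ?_) hij hi hj
      nlinarith [hu hij]
    · refine not_signCrossing_of_lt_of_monotone (fun i j hij => ?_) hij hi.neg hj.neg
      nlinarith [hu hij]
  refine Finset.card_le_one.2 fun i hi j hj => ?_
  simp only [Finset.mem_filter] at hi hj
  rcases lt_trichotomy i j with h | h | h
  · exact absurd hj.2 (hmono i j h hi.2)
  · exact h
  · exact absurd hi.2 (hmono j i h hj.2)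

/-! ### Variation over line segments -/

theorem lineFun_lineMap_self (a b : ℂ) (c t : ℝ) :
    lineFun (AffineMap.lineMap a b c) (b - a) (AffineMap.lineMap a b t)
      = (t - c) * Complex.normSq (b - a) := by
  simp [lineFun, AffineMap.lineMap_apply, Complex.normSq_apply]; ring

theorem normSq_sub_pos {a b : ℂ} (hab : a ≠ b) : 0 < Complex.normSq (b - a) :=
  Complex.normSq_pos.2 (sub_ne_zero.2 hab.symm)

theorem mem_line_iff_lineFun {a b z : ℂ} (hab : a ≠ b) :
    (∃ t : ℝ, AffineMap.lineMap a b t = z) ↔ lineFun a (-Complex.I * (b - a)) z = 0 := by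
  have h : -Complex.I * (b - a) ≠ 0 := mul_ne_zero (by simp) (sub_ne_zero.2 hab.symm)
  rw [← mem_line_iff h, ← mem_affineSpan_pair_iff_exists_lineMap_eq,
    ← mul_assoc]
  simp

open Classical in
/-- The steps of a list inside a segment contribute at most the variation along the segment,
multiplied by the variation factor of the whole list. -/
theorem sum_steps_in_segment_le {a b : ℂ} (hab : a ≠ b) {l r : ℝ} (hlr : l < r) {K : Set ℂ}
    (hK : K = AffineMap.lineMap a b '' Set.Icc l r) (F : ℂ → ℂ) (x : ℕ → ℂ) (n : ℕ) :
    ∑ i ∈ (Finset.range n).filter (fun i => x i ∈ K ∧ x (i + 1) ∈ K), ‖F (x (i + 1)) - F (x i)‖ₑ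
      ≤ vf n x * eVariationOn (fun t => F (AffineMap.lineMap a b t)) (Set.Icc l r) := by
  have hex : ∀ i, ∃ t : ℝ, x i ∈ K → t ∈ Set.Icc l r ∧ AffineMap.lineMap a b t = x i := by
    intro i
    by_cases h : x i ∈ K
    · rw [hK] at h
      obtain ⟨t, ht, e⟩ := h
      exact ⟨t, fun _ => ⟨ht, e⟩⟩
    · exact ⟨0, fun h' => absurd h' h⟩
  choose t ht using hex
  set J := (Finset.range n).filter (fun i => x i ∈ K ∧ x (i + 1) ∈ K)
  set g := fun t : ℝ => F (AffineMap.lineMap a b t)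
  have h1 : ∀ i ∈ J, ‖F (x (i + 1)) - F (x i)‖ₑ ≤ eVariationOn g
      (Set.Icc (min (t i) (t (i + 1))) (max (t i) (t (i + 1))) ∩ Set.Icc l r) := by
    intro i hi
    obtain ⟨-, hi1, hi2⟩ := Finset.mem_filter.1 hi
    obtain ⟨h1, e1⟩ := ht i hi1
    obtain ⟨h2, e2⟩ := ht (i + 1) hi2
    rw [← edist_eq_enorm_sub, ← e1, ← e2]
    exact eVariationOn.edist_le g ⟨⟨min_le_right _ _, le_max_right _ _⟩, h2⟩
      ⟨⟨min_le_left _ _, le_max_left _ _⟩, h1⟩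
  refine (Finset.sum_le_sum h1).trans ?_
  -- The comparison family is `vf n x` copies of `[l, r]`. A step whose parameters lie strictly on
  -- both sides of `c` crosses the perpendicular at `c`, so at most `vf n x` steps cover `c`.
  refine (sum_eVariationOn_inter_le g J (Finset.range (vf n x)) _ _ (fun _ => l) (fun _ => r) hlr
    ?_).trans (le_of_eq ?_)
  · intro c hc hJ _
    rw [Finset.filter_true_of_mem (s := Finset.range (vf n x)) fun _ _ => ⟨hc.1.le, hc.2.le⟩,
      Finset.card_range]
    rcases eq_or_ne n 0 with rfl | hn
    · simp [J]
    refine le_trans (Finset.card_le_card fun i hi => ?_)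
      (card_signCrossing_le_vf (p := AffineMap.lineMap a b c) (sub_ne_zero.2 hab.symm) x hn)
    obtain ⟨hiJ, hi3, hi4⟩ := Finset.mem_filter.1 hi
    obtain ⟨hi0, hi1, hi2⟩ := Finset.mem_filter.1 hiJ
    refine Finset.mem_filter.2 ⟨hi0, Or.inl ?_⟩
    obtain ⟨hne1, hne2⟩ := hJ i hiJ
    have h3 := lt_of_le_of_ne hi3 hne1.symm
    have h4 := lt_of_le_of_ne hi4 hne2
    simp only
    rw [← (ht i hi1).2, ← (ht (i + 1) hi2).2, lineFun_lineMap_self, lineFun_lineMap_self]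
    have hpos := normSq_sub_pos hab
    have : (t i - c) * (t (i + 1) - c) < 0 := by
      rcases min_lt_iff.1 h3 with h | h <;> rcases lt_max_iff.1 h4 with h' | h'
      · linarith
      · exact mul_neg_of_neg_of_pos (by linarith) (by linarith)
      · exact mul_neg_of_pos_of_neg (by linarith) (by linarith)
      · linarith
    calc _ = ((t i - c) * (t (i + 1) - c)) * (Complex.normSq (b - a) * Complex.normSq (b - a)) := by
            ring
      _ < 0 := mul_neg_of_neg_of_pos this (mul_pos hpos hpos)
  · simp

theorem var_eq_zero_of_subsingleton {K : Set ℂ} (hK : K.Subsingleton) (f : K → ℂ) : var f = 0 := by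
  have : Subsingleton K := hK.coe_sort
  simp [var, cvar, fun (x : ℕ → K) i =>
    congrArg f (Subsingleton.elim (x (i + 1)) (x i))]

theorem var_le_iff {σ : Set ℂ} {f : σ → ℂ} {C : ℝ≥0∞} :
    var f ≤ C ↔ ∀ (n : ℕ) (x : ℕ → σ), cvar f n x ≤ vf n (fun i => (x i : ℂ)) * C := by
  simp only [var, iSup_le_iff]
  refine forall_congr' fun n => forall_congr' fun x => ?_
  have hv : (vf n (fun i => (x i : ℂ)) : ℝ≥0∞) ≠ 0 := by
    have := one_le_vf n (fun i => (x i : ℂ))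
    exact_mod_cast (by omega : vf n (fun i => (x i : ℂ)) ≠ 0)
  rw [ENNReal.div_le_iff' hv (ENNReal.natCast_ne_top _)]

theorem cvar_le_vf_mul_var {σ : Set ℂ} (f : σ → ℂ) (n : ℕ) (x : ℕ → σ) :
    cvar f n x ≤ vf n (fun i => (x i : ℂ)) * var f := var_le_iff.1 le_rfl n x

/-- The two-dimensional variation over a segment is the usual variation of a parametrization. -/
theorem var_segment {a b : ℂ} (hab : a ≠ b) (l r : ℝ) {K : Set ℂ}
    (hK : K = AffineMap.lineMap a b '' Set.Icc l r) (F : ℂ → ℂ) :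
    var (fun z : K => F z)
      = eVariationOn (fun t => F (AffineMap.lineMap a b t)) (Set.Icc l r) := by
  classical
  -- Empty and one-point intervals are admitted because intersections of segments may be of this
  -- kind.
  rcases le_or_gt r l with hlr | hlr
  · have h : (Set.Icc l r).Subsingleton := Set.subsingleton_Icc_of_ge hlr
    rw [eVariationOn.subsingleton _ h, var_eq_zero_of_subsingleton (hK ▸ h.image _)]
  refine le_antisymm (var_le_iff.2 fun n x => ?_) ?_
  · refine le_trans (le_of_eq ?_) (sum_steps_in_segment_le hab hlr hK F (fun i => (x i : ℂ)) n)
    rw [Finset.filter_true_of_mem fun i _ => ⟨(x i).2, (x (i + 1)).2⟩, cvar]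
  -- A monotone partition gives a list of variation factor one, so its sum occurs undivided in the
  -- planar variation.
  · refine iSup_le fun p => ?_
    obtain ⟨n, u, hu, hur⟩ := p
    have hm : ∀ i, (AffineMap.lineMap a b (u i) : ℂ) ∈ K := fun i => hK ▸ ⟨_, hur i, rfl⟩
    have h := cvar_le_vf_mul_var (fun z : K => F z) n (fun i => ⟨_, hm i⟩)
    have h1 : vf n (fun i => AffineMap.lineMap a b (u i)) = 1 :=
      le_antisymm (vf_lineMap_le_one a b hu n) (one_le_vf _ _)
    simp only [h1, Nat.cast_one, one_mul] at h
    refine le_trans (le_of_eq ?_) h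
    exact Finset.sum_congr rfl fun i _ => edist_eq_enorm_sub _ _

theorem var_segment_eq {a b : ℂ} (hab : a ≠ b) (F : ℂ → ℂ) :
    var (fun z : segment ℝ a b => F z)
      = eVariationOn (fun t => F (AffineMap.lineMap a b t)) (Set.Icc (0 : ℝ) 1) :=
  var_segment hab 0 1 (segment_eq_image_lineMap ℝ a b) F

theorem var_restrict_le {K σ : Set ℂ} (h : K ⊆ σ) (f : σ → ℂ) :
    var (f ∘ Set.inclusion h) ≤ var f :=
  iSup₂_le fun n x => div_le_var f n (fun i => Set.inclusion h (x i))

/-! ### Comparison of the two norms -/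

/-- Membership in a segment is decided by the position relative to three lines: the line through it
and the perpendiculars at its two endpoints. -/
theorem sign_ne_of_mem_segment {a b p q : ℂ} (hab : a ≠ b) (hp : p ∈ segment ℝ a b)
    (hq : q ∉ segment ℝ a b) :
    SignType.sign (lineFun a (-Complex.I * (b - a)) p)
        ≠ SignType.sign (lineFun a (-Complex.I * (b - a)) q) ∨
      SignType.sign (lineFun a (b - a) p) ≠ SignType.sign (lineFun a (b - a) q) ∨
      SignType.sign (lineFun b (b - a) p) ≠ SignType.sign (lineFun b (b - a) q) := by
  rw [segment_eq_image_lineMap] at hp hq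
  obtain ⟨s, ⟨hs0, hs1⟩, rfl⟩ := hp
  have hp0 := (mem_line_iff_lineFun hab).1 ⟨s, rfl⟩
  by_cases h : lineFun a (-Complex.I * (b - a)) q = 0
  · right
    obtain ⟨t, rfl⟩ := (mem_line_iff_lineFun hab).2 h
    have hpos := normSq_sub_pos hab
    have ea := lineFun_lineMap_self a b 0
    have eb := lineFun_lineMap_self a b 1
    rw [AffineMap.lineMap_apply_zero] at ea
    rw [AffineMap.lineMap_apply_one] at eb
    rw [ea, ea, eb, eb]
    rcases lt_or_ge t 0 with h0 | h0
    · left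
      rw [sign_neg (a := (t - 0) * _) (mul_neg_of_neg_of_pos (by linarith) hpos)]
      have h1 : 0 ≤ (s - 0) * Complex.normSq (b - a) := mul_nonneg (by linarith) hpos.le
      intro h2
      exact absurd (sign_eq_neg_one_iff.1 h2) (not_lt.2 h1)
    · have h1 : 1 < t := by
        by_contra h1
        exact hq ⟨t, ⟨h0, not_lt.1 h1⟩, rfl⟩
      right
      rw [sign_pos (a := (t - 1) * _) (mul_pos (by linarith) hpos)]
      have h1 : (s - 1) * Complex.normSq (b - a) ≤ 0 :=
        mul_nonpos_of_nonpos_of_nonneg (by linarith) hpos.le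
      intro h2
      exact absurd (sign_eq_one_iff.1 h2) (not_lt.2 h1)
  · left
    rw [hp0, sign_zero]
    exact fun h' => h (sign_eq_zero_iff.1 h'.symm)

-- The constant is three lines times the factor three of `card_sign_ne_le_vf`.
open Classical in
theorem card_leave_segment_le {a b : ℂ} (hab : a ≠ b) (x : ℕ → ℂ) (n : ℕ) :
    ((Finset.range n).filter fun i => x i ∈ segment ℝ a b ∧ x (i + 1) ∉ segment ℝ a b).card
      ≤ 9 * vf n x := by
  have hd : b - a ≠ 0 := sub_ne_zero.2 hab.symm
  have hd' : -Complex.I * (b - a) ≠ 0 := mul_ne_zero (by simp) hd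
  have h1 := card_sign_ne_le_vf (p := a) hd' x n
  have h2 := card_sign_ne_le_vf (p := a) hd x n
  have h3 := card_sign_ne_le_vf (p := b) hd x n
  have h4 := Finset.card_le_card (s := (Finset.range n).filter fun i =>
      x i ∈ segment ℝ a b ∧ x (i + 1) ∉ segment ℝ a b)
    (t := ((Finset.range n).filter fun i => SignType.sign (lineFun a (-Complex.I * (b - a)) (x i))
        ≠ SignType.sign (lineFun a (-Complex.I * (b - a)) (x (i + 1)))) ∪
      (((Finset.range n).filter fun i => SignType.sign (lineFun a (b - a) (x i))
        ≠ SignType.sign (lineFun a (b - a) (x (i + 1)))) ∪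
      ((Finset.range n).filter fun i => SignType.sign (lineFun b (b - a) (x i))
        ≠ SignType.sign (lineFun b (b - a) (x (i + 1)))))) (fun i hi => by
      obtain ⟨h0, hp, hq⟩ := Finset.mem_filter.1 hi
      simp only [Finset.mem_union, Finset.mem_filter]
      rcases sign_ne_of_mem_segment hab hp hq with h | h | h
      · exact Or.inl ⟨h0, h⟩
      · exact Or.inr (Or.inl ⟨h0, h⟩)
      · exact Or.inr (Or.inr ⟨h0, h⟩))
  have h5 := Finset.card_union_le ((Finset.range n).filter fun i =>
      SignType.sign (lineFun a (-Complex.I * (b - a)) (x i))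
        ≠ SignType.sign (lineFun a (-Complex.I * (b - a)) (x (i + 1))))
      (((Finset.range n).filter fun i => SignType.sign (lineFun a (b - a) (x i))
        ≠ SignType.sign (lineFun a (b - a) (x (i + 1)))) ∪
      ((Finset.range n).filter fun i => SignType.sign (lineFun b (b - a) (x i))
        ≠ SignType.sign (lineFun b (b - a) (x (i + 1)))))
  have h6 := Finset.card_union_le ((Finset.range n).filter fun i =>
      SignType.sign (lineFun a (b - a) (x i)) ≠ SignType.sign (lineFun a (b - a) (x (i + 1))))
      ((Finset.range n).filter fun i => SignType.sign (lineFun b (b - a) (x i))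
        ≠ SignType.sign (lineFun b (b - a) (x (i + 1))))
  omega

/-- The variation over a finite union of segments is controlled by the variations over the
segments and the supremum norm. -/
theorem var_le_sum_segments {σ : Set ℂ} {m : ℕ} {a b : Fin m → ℂ} (hab : ∀ k, a k ≠ b k)
    (hσ : σ ⊆ ⋃ k, segment ℝ (a k) (b k)) (F : ℂ → ℂ) :
    var (fun z : σ => F z) ≤ ∑ k, var (fun z : segment ℝ (a k) (b k) => F z)
      + 18 * m * supNorm (fun z : σ => F z) := by
  classical
  refine var_le_iff.2 fun n x => ?_
  set B := supNorm (fun z : σ => F z)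
  set V : ℝ≥0∞ := (vf n (fun i => (x i : ℂ)) : ℝ≥0∞)
  have hstep : ∀ i, ‖F (x (i + 1)) - F (x i)‖ₑ ≤ 2 * B := fun i => by
    refine enorm_sub_le.trans ?_
    rw [two_mul]
    exact add_le_add (le_supNorm (fun z : σ => F z) _) (le_supNorm (fun z : σ => F z) _)
  -- Some segment contains the start of the step. Either the step ends in that segment too, or it
  -- leaves it and is bounded by `2 * B`; nine departures per unit of `vf` then give the constant
  -- 18.
  have hpt : ∀ i, ‖F (x (i + 1)) - F (x i)‖ₑ ≤ ∑ k,
      ((if (x i : ℂ) ∈ segment ℝ (a k) (b k) ∧ (x (i + 1) : ℂ) ∈ segment ℝ (a k) (b k)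
          then ‖F (x (i + 1)) - F (x i)‖ₑ else 0) +
        if (x i : ℂ) ∈ segment ℝ (a k) (b k) ∧ (x (i + 1) : ℂ) ∉ segment ℝ (a k) (b k)
          then 2 * B else 0) := by
    intro i
    obtain ⟨k, hk⟩ := Set.mem_iUnion.1 (hσ (x i).2)
    refine le_trans ?_ (Finset.single_le_sum (fun _ _ => zero_le) (Finset.mem_univ k))
    by_cases h : (x (i + 1) : ℂ) ∈ segment ℝ (a k) (b k)
    · simp [hk, h]
    · simpa [hk, h] using hstep i
  calc cvar (fun z : σ => F z) n x
      ≤ ∑ i ∈ Finset.range n, ∑ k,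
      ((if (x i : ℂ) ∈ segment ℝ (a k) (b k) ∧ (x (i + 1) : ℂ) ∈ segment ℝ (a k) (b k)
          then ‖F (x (i + 1)) - F (x i)‖ₑ else 0) +
        if (x i : ℂ) ∈ segment ℝ (a k) (b k) ∧ (x (i + 1) : ℂ) ∉ segment ℝ (a k) (b k)
          then 2 * B else 0) := Finset.sum_le_sum fun i _ => hpt i
    _ ≤ ∑ k, (V * var (fun z : segment ℝ (a k) (b k) => F z) + 9 * V * (2 * B)) := by
        rw [Finset.sum_comm]
        refine Finset.sum_le_sum fun k _ => ?_
        rw [Finset.sum_add_distrib, ← Finset.sum_filter, ← Finset.sum_filter, var_segment_eq (hab k)]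
        refine add_le_add (sum_steps_in_segment_le (hab k) zero_lt_one
          (segment_eq_image_lineMap ℝ _ _) F (fun i => (x i : ℂ)) n) ?_
        rw [Finset.sum_const, nsmul_eq_mul]
        gcongr
        have := card_leave_segment_le (hab k) (fun i => (x i : ℂ)) n
        calc ((_ : ℕ) : ℝ≥0∞) ≤ ((9 * vf n (fun i => (x i : ℂ)) : ℕ) : ℝ≥0∞) := by exact_mod_cast this
          _ = _ := by push_cast; rfl
    _ = _ := by
        rw [Finset.sum_add_distrib, ← Finset.mul_sum, Finset.sum_const, Finset.card_univ,
          Fintype.card_fin, nsmul_eq_mul]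
        ring

/-! ### The `LG` norm does not depend on the representation -/

/-- The set of parameters is a compact convex subset of the real line. -/
theorem exists_Icc_eq (a b c d : ℂ) :
    ∃ l r : ℝ, Set.Icc l r
      = (fun t : ℝ => (AffineMap.lineMap a b t : ℂ)) ⁻¹' segment ℝ c d ∩ Set.Icc (0 : ℝ) 1 := by
  set T := (fun t : ℝ => (AffineMap.lineMap a b t : ℂ)) ⁻¹' segment ℝ c d ∩ Set.Icc (0 : ℝ) 1
  have hconv : Convex ℝ T :=
    ((convex_segment c d).affine_preimage (AffineMap.lineMap a b)).inter (convex_Icc 0 1)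
  have hcl : IsClosed (segment ℝ c d) := by
    rw [segment_eq_image_lineMap]
    exact (isCompact_Icc.image (by fun_prop)).isClosed
  have hcomp : IsCompact T :=
    isCompact_Icc.inter_left (hcl.preimage (by fun_prop))
  rcases T.eq_empty_or_nonempty with h | h
  · exact ⟨1, 0, by rw [h]; simp⟩
  · refine ⟨sInf T, sSup T, ?_⟩
    exact (eq_Icc_of_connected_compact ⟨h, hconv.isPreconnected⟩ hcomp).symm

/-- The restriction to a segment of a nontrivial set has a variation that is additive along any
proper representation. -/
theorem ProperRep.var_segment_eq_sum {σ : Set ℂ} {m : ℕ} (r : ProperRep σ m) {a b : ℂ}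
    (hab : a ≠ b) (hσ : segment ℝ a b ⊆ σ) (F : ℂ → ℂ) :
    var (fun z : segment ℝ a b => F z)
      = ∑ j, var (fun z : (segment ℝ a b ∩ r.seg j : Set ℂ) => F z) := by
  classical
  have hex : ∀ j, ∃ l r' : ℝ, Set.Icc l r' = (fun t : ℝ => (AffineMap.lineMap a b t : ℂ)) ⁻¹'
      r.seg j ∩ Set.Icc (0 : ℝ) 1 := fun j => exists_Icc_eq _ _ _ _
  choose l r' hl using hex
  have hK : ∀ j, segment ℝ a b ∩ r.seg j = AffineMap.lineMap a b '' Set.Icc (l j) (r' j) := by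
    intro j
    rw [hl, Set.inter_comm (_ ⁻¹' _), segment_eq_image_lineMap]
    exact (Set.image_inter_preimage _ _ _).symm
  have hinj : Function.Injective (AffineMap.lineMap a b : ℝ → ℂ) :=
    AffineMap.lineMap_injective ℝ hab
  have hle : ∀ j, Set.Icc (l j) (r' j) ∩ Set.Icc 0 1 = Set.Icc (l j) (r' j) := fun j =>
    Set.inter_eq_left.2 (hl j ▸ Set.inter_subset_right)
  set g := fun t : ℝ => F (AffineMap.lineMap a b t)
  -- Two parameter intervals with a common interior point overlap in infinitely many points, whereas
  -- distinct segments of `r` share only endpoints. So, endpoints aside, the intervals cover `(0,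
  -- 1)` exactly once.
  have hone : ∀ c ∈ Set.Ioo (0 : ℝ) 1, (∀ j, c ≠ l j ∧ c ≠ r' j) →
      (Finset.univ.filter fun j => c ∈ Set.Icc (l j) (r' j)).card = 1 := by
    intro c hc hne
    have hcσ : (AffineMap.lineMap a b c : ℂ) ∈ σ := hσ (by
      rw [segment_eq_image_lineMap]; exact ⟨c, ⟨hc.1.le, hc.2.le⟩, rfl⟩)
    rw [← r.union_eq] at hcσ
    obtain ⟨j, hj⟩ := Set.mem_iUnion.1 hcσ
    have hj' : c ∈ Set.Icc (l j) (r' j) := by rw [hl]; exact ⟨hj, hc.1.le, hc.2.le⟩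
    refine Finset.card_eq_one.2 ⟨j, Finset.eq_singleton_iff_unique_mem.2
      ⟨by simpa using hj', fun k hk => ?_⟩⟩
    by_contra hkj
    have hk' : c ∈ Set.Icc (l k) (r' k) := (Finset.mem_filter.1 hk).2
    have hlt : ∀ i, c ∈ Set.Icc (l i) (r' i) → l i < c ∧ c < r' i := fun i hi =>
      ⟨lt_of_le_of_ne hi.1 (hne i).1.symm, lt_of_le_of_ne hi.2 (hne i).2⟩
    have hfin : ((AffineMap.lineMap a b : ℝ → ℂ) '' Set.Ioo (max (l j) (l k)) c).Finite := by
      refine (Set.toFinite ({r.left k, r.right k} : Set ℂ)).subset ?_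
      rintro _ ⟨t, ⟨ht1, ht2⟩, rfl⟩
      have h1 : t ∈ Set.Icc (l j) (r' j) :=
        ⟨((le_max_left _ _).trans_lt ht1).le, (ht2.trans (hlt j hj').2).le⟩
      have h2 : t ∈ Set.Icc (l k) (r' k) :=
        ⟨((le_max_right _ _).trans_lt ht1).le, (ht2.trans (hlt k hk').2).le⟩
      rw [hl] at h1 h2
      exact (r.inter_subset k j hkj ⟨h2.1, h1.1⟩).1
    exact (Set.Ioo_infinite (max_lt (hlt j hj').1 (hlt k hk').1)).image hinj.injOn hfin
  -- Equal covering numbers allow the comparison of variations in both directions.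
  have hmain : ∑ j, eVariationOn g (Set.Icc (l j) (r' j) ∩ Set.Icc 0 1)
      = ∑ _j : Fin 1, eVariationOn g (Set.Icc 0 1 ∩ Set.Icc 0 1) := by
    have h1 : ∀ c ∈ Set.Ioo (0 : ℝ) 1,
        ((Finset.univ : Finset (Fin 1)).filter fun _ => c ∈ Set.Icc (0 : ℝ) 1).card = 1 :=
      fun c hc => by simp [hc.1.le, hc.2.le]
    refine le_antisymm ?_ ?_
    · exact sum_eVariationOn_inter_le g _ _ l r' _ _ zero_lt_one fun c hc hj _ =>
        (hone c hc fun j => hj j (Finset.mem_univ j)).le.trans (h1 c hc).ge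
    · exact sum_eVariationOn_inter_le g _ _ _ _ l r' zero_lt_one fun c hc _ hj =>
        (h1 c hc).le.trans (hone c hc fun j => hj j (Finset.mem_univ j)).ge
  rw [var_segment_eq hab, Finset.sum_congr rfl fun j _ => var_segment hab _ _ (hK j) F]
  simpa [hle] using hmain.symm

/-- With `f` extended by zero to the plane, its restrictions to different segments and their
intersections are all restrictions of one function `F`. -/
theorem ProperRep.exists_lgNorm_eq {σ : Set ℂ} (f : σ → ℂ) :
    ∃ F : ℂ → ℂ, f = (fun z : σ => F z) ∧ ∀ {m : ℕ} (r : ProperRep σ m),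
      r.lgNorm f = supNorm f + ∑ k, var (fun z : segment ℝ (r.left k) (r.right k) => F z) := by
  have h : ∀ z : σ, Function.extend Subtype.val f 0 (z : ℂ) = f z :=
    fun z => Subtype.val_injective.extend_apply f 0 z
  refine ⟨Function.extend Subtype.val f 0, funext fun z => (h z).symm, fun r => ?_⟩
  rw [ProperRep.lgNorm]
  congr 1
  refine Finset.sum_congr rfl fun k _ => ?_
  change var _ = var (fun z : r.seg k => _)
  congr 1
  funext z
  exact (h (Set.inclusion (r.seg_subset k) z)).symm

theorem var_congr_set {K K' : Set ℂ} (h : K = K') (F : ℂ → ℂ) :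
    var (fun z : K => F z) = var (fun z : K' => F z) := by subst h; rfl

theorem ProperRep.lgNorm_eq_of_subsingleton {σ : Set ℂ} {m : ℕ} (r : ProperRep σ m)
    (hσ : σ.Subsingleton) (f : σ → ℂ) : r.lgNorm f = supNorm f := by
  rw [ProperRep.lgNorm, Finset.sum_eq_zero, add_zero]
  exact fun k _ => var_eq_zero_of_subsingleton (hσ.anti (r.seg_subset k)) _

/-- Cutting the segments of each representation along the other turns both sums into the same double
sum over pairwise intersections. -/
theorem ProperRep.lgNorm_eq {σ : Set ℂ} {m m' : ℕ} (r : ProperRep σ m) (r' : ProperRep σ m')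
    (f : σ → ℂ) : r.lgNorm f = r'.lgNorm f := by
  rcases σ.subsingleton_or_nontrivial with hσ | hσ
  · rw [r.lgNorm_eq_of_subsingleton hσ, r'.lgNorm_eq_of_subsingleton hσ]
  obtain ⟨F, -, hF⟩ := ProperRep.exists_lgNorm_eq f
  rw [hF, hF]
  congr 1
  rw [Finset.sum_congr rfl fun k _ =>
      r'.var_segment_eq_sum (r.left_ne_right hσ k) (r.seg_subset k) F,
    Finset.sum_congr rfl fun k _ =>
      r.var_segment_eq_sum (r'.left_ne_right hσ k) (r'.seg_subset k) F, Finset.sum_comm]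
  exact Finset.sum_congr rfl fun j _ => Finset.sum_congr rfl fun k _ =>
    var_congr_set (Set.inter_comm _ _) F

theorem ProperRep.lgNorm_le {σ : Set ℂ} {m : ℕ} (r : ProperRep σ m) (f : σ → ℂ) :
    r.lgNorm f ≤ (m + 1) * bvNorm f := by
  rw [ProperRep.lgNorm, add_mul, one_mul, add_comm]
  refine add_le_add ?_ (supNorm_le_bvNorm f)
  refine (Finset.sum_le_sum fun k _ =>
    (var_restrict_le (r.seg_subset k) f).trans (le_add_self : var f ≤ bvNorm f)).trans ?_
  simp [bvNorm, mul_add]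

theorem ProperRep.bvNorm_le {σ : Set ℂ} {m : ℕ} (r : ProperRep σ m) (f : σ → ℂ) :
    bvNorm f ≤ (18 * m + 1) * r.lgNorm f := by
  rcases σ.subsingleton_or_nontrivial with hσ | hσ
  · rw [bvNorm, var_eq_zero_of_subsingleton hσ, add_zero, r.lgNorm_eq_of_subsingleton hσ, add_mul,
      one_mul]
    exact le_add_self
  obtain ⟨F, rfl, hF⟩ := ProperRep.exists_lgNorm_eq f
  have h := var_le_sum_segments (r.left_ne_right hσ) r.union_eq.ge F
  rw [hF, bvNorm]
  set A := ∑ k, var (fun z : segment ℝ (r.left k) (r.right k) => F z)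
  set B := supNorm (fun z : σ => F z)
  calc B + var (fun z : σ => F z) ≤ B + (A + 18 * m * B) := add_le_add le_rfl h
    -- The added term completes the product `(18 * m + 1) * (B + A)`.
    _ ≤ B + (A + 18 * m * B) + 18 * m * A := le_self_add
    _ = _ := by ring

/-! ### Subdivision of linear graphs -/

theorem lineMap_eq_zero_of_two {g₀ g₁ v w : ℝ} (hvw : v ≠ w) (hv : (1 - v) * g₀ + v * g₁ = 0)
    (hw : (1 - w) * g₀ + w * g₁ = 0) : g₀ = 0 ∧ g₁ = 0 := by
  have h : (v - w) * (g₁ - g₀) = 0 := by linear_combination hv - hw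
  have h2 : g₁ = g₀ := by
    rcases mul_eq_zero.1 h with h | h
    · exact absurd (sub_eq_zero.1 h) hvw
    · exact sub_eq_zero.1 h
  subst h2
  have : g₁ = 0 := by linear_combination hv
  exact ⟨this, this⟩

/-- The affine function defining the line through `a` and `b` vanishes at two points of the other
segment, hence on all of it. -/
theorem segment_subset_line {a b c d : ℂ} (hab : a ≠ b)
    (h : ¬ (segment ℝ a b ∩ segment ℝ c d).Subsingleton) :
    ∀ z ∈ segment ℝ c d, ∃ t : ℝ, AffineMap.lineMap a b t = z := by
  rw [Set.not_subsingleton_iff] at h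
  obtain ⟨y, ⟨hy1, hy2⟩, y', ⟨hy1', hy2'⟩, hne⟩ := h
  rw [segment_eq_image_lineMap] at hy1 hy2 hy1' hy2'
  obtain ⟨t, -, ht⟩ := hy1
  obtain ⟨t', -, ht'⟩ := hy1'
  obtain ⟨v, -, hv⟩ := hy2
  obtain ⟨v', -, hv'⟩ := hy2'
  have e := (mem_line_iff_lineFun hab).1 ⟨t, ht⟩
  have e' := (mem_line_iff_lineFun hab).1 ⟨t', ht'⟩
  rw [← hv, lineFun_lineMap] at e
  rw [← hv', lineFun_lineMap] at e'
  have hvv : v ≠ v' := by rintro rfl; exact hne (hv.symm.trans hv')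
  obtain ⟨h0, h1⟩ := lineMap_eq_zero_of_two hvv e e'
  intro z hz
  rw [segment_eq_image_lineMap] at hz
  obtain ⟨u, -, rfl⟩ := hz
  refine (mem_line_iff_lineFun hab).2 ?_
  rw [lineFun_lineMap, h0, h1]; ring

theorem isClosed_segment (a b : ℂ) : IsClosed (segment ℝ a b) := by
  rw [segment_eq_image_lineMap]
  exact (isCompact_Icc.image (by fun_prop)).isClosed

/-- The points `a` and `b` are consecutive points of `W`, joined by a segment whose interior is open
in `σ`. -/
structure IsEdge {σ : Set ℂ} (W : Set σ) (a b : σ) : Prop where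
  left_mem : a ∈ W
  right_mem : b ∈ W
  ne : a ≠ b
  subset : openSegment ℝ (a : ℂ) b ⊆ σ
  avoid : ∀ z ∈ W, (z : ℂ) ∉ openSegment ℝ (a : ℂ) b
  isOpen : IsOpen ((↑) ⁻¹' openSegment ℝ (a : ℂ) b : Set σ)

theorem openSegment_lineMap {a b : ℂ} {s t : ℝ} (hst : s < t) :
    openSegment ℝ (AffineMap.lineMap a b s : ℂ) (AffineMap.lineMap a b t)
      = (AffineMap.lineMap a b : ℝ → ℂ) '' Set.Ioo s t := by
  rw [← openSegment_eq_Ioo hst, image_openSegment]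

/-- A finite union of segments is subdivided into edges by every finite set of points that contains
certain finitely many ones. -/
theorem exists_subdivision {σ : Set ℂ} (S : Finset (ℂ × ℂ))
    (hσ : σ = ⋃ e ∈ S, segment ℝ e.1 e.2) :
    ∃ V : Set σ, V.Finite ∧ ∀ W : Set σ, W.Finite → V ⊆ W → ∀ z ∉ W,
      ∃ a b, IsEdge W a b ∧ (z : ℂ) ∈ openSegment ℝ (a : ℂ) b := by
  -- The endpoints of the given segments, and every point in which two of them meet just once. Pairs
  -- with more common points are collinear and need no further vertices.
  set V : Set ℂ := (⋃ e ∈ S, {e.1, e.2}) ∪ ⋃ e ∈ S, ⋃ e' ∈ S,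
    {z | (segment ℝ e.1 e.2 ∩ segment ℝ e'.1 e'.2).Subsingleton ∧
      z ∈ segment ℝ e.1 e.2 ∩ segment ℝ e'.1 e'.2} with hV
  have hVfin : V.Finite := by
    refine Set.Finite.union (S.finite_toSet.biUnion fun e _ => Set.toFinite _)
      (S.finite_toSet.biUnion fun e _ => S.finite_toSet.biUnion fun e' _ => ?_)
    exact Set.Subsingleton.finite fun x hx y hy => hx.1 hx.2 hy.2
  refine ⟨(↑) ⁻¹' V, hVfin.preimage Subtype.val_injective.injOn, fun W hW hVW z hz => ?_⟩
  have hmem : ∀ e ∈ S, segment ℝ e.1 e.2 ⊆ σ := fun e he => by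
    rw [hσ]; exact Set.subset_biUnion_of_mem (u := fun e : ℂ × ℂ => segment ℝ e.1 e.2) he
  have hzσ : (z : ℂ) ∈ ⋃ e ∈ S, segment ℝ e.1 e.2 := hσ ▸ z.2
  obtain ⟨e, he, hze⟩ := Set.mem_iUnion₂.1 hzσ
  have hp1 : (⟨e.1, hmem e he (left_mem_segment ℝ _ _)⟩ : σ) ∈ W :=
    hVW (Or.inl (Set.mem_iUnion₂.2 ⟨e, he, by simp⟩))
  have hp2 : (⟨e.2, hmem e he (right_mem_segment ℝ _ _)⟩ : σ) ∈ W :=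
    hVW (Or.inl (Set.mem_iUnion₂.2 ⟨e, he, by simp⟩))
  have hne : e.1 ≠ e.2 := by
    intro h
    rw [← h, segment_same, Set.mem_singleton_iff] at hze
    exact hz (by rwa [show z = ⟨e.1, hmem e he (left_mem_segment ℝ _ _)⟩ from Subtype.ext hze])
  have hinj : Function.Injective (AffineMap.lineMap e.1 e.2 : ℝ → ℂ) :=
    AffineMap.lineMap_injective ℝ hne
  have hze' := hze
  rw [segment_eq_image_lineMap] at hze'
  obtain ⟨t₀, ⟨ht0, ht1⟩, htz⟩ := hze'
  set T : Set ℝ := (AffineMap.lineMap e.1 e.2 : ℝ → ℂ) ⁻¹' ((↑) '' W) with hT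
  have hTfin : T.Finite := (hW.image _).preimage hinj.injOn
  have h0T : (0 : ℝ) ∈ T := ⟨_, hp1, by simp⟩
  have h1T : (1 : ℝ) ∈ T := ⟨_, hp2, by simp⟩
  have ht₀ : t₀ ∉ T := by
    rintro ⟨w, hw, e⟩
    exact hz (by rwa [← Subtype.ext (e.trans htz)])
  have hlt0 : 0 < t₀ := lt_of_le_of_ne ht0 fun h => ht₀ (h ▸ h0T)
  have hlt1 : t₀ < 1 := lt_of_le_of_ne ht1 fun h => ht₀ (h ▸ h1T)
  -- The edge through `z` runs between the points of `W` on `e` nearest to `z` on either side.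
  obtain ⟨s, ⟨hsT, hs⟩, hsmax⟩ := Set.exists_max_image (T ∩ Set.Iio t₀) id
    (hTfin.subset Set.inter_subset_left) ⟨0, h0T, hlt0⟩
  obtain ⟨s', ⟨hsT', hs'⟩, hsmin⟩ := Set.exists_min_image (T ∩ Set.Ioi t₀) id
    (hTfin.subset Set.inter_subset_left) ⟨1, h1T, hlt1⟩
  simp only [id] at hsmax hsmin
  rw [Set.mem_Iio] at hs
  rw [Set.mem_Ioi] at hs'
  have hs0 : 0 ≤ s := hsmax 0 ⟨h0T, hlt0⟩
  have hs1 : s' ≤ 1 := hsmin 1 ⟨h1T, hlt1⟩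
  have hss : s < s' := hs.trans hs'
  have havoid : ∀ t ∈ Set.Ioo s s', t ∉ T := by
    rintro t ⟨h1, h2⟩ ht
    rcases lt_trichotomy t t₀ with h | h | h
    · exact absurd (hsmax t ⟨ht, h⟩) (not_le.2 h1)
    · exact ht₀ (h ▸ ht)
    · exact absurd (hsmin t ⟨ht, h⟩) (not_le.2 h2)
  obtain ⟨a, ha, hae⟩ := hsT
  obtain ⟨b, hb, hbe⟩ := hsT'
  have hO := openSegment_lineMap (a := e.1) (b := e.2) hss
  rw [← hae, ← hbe] at hO
  have hsub : openSegment ℝ (a : ℂ) b ⊆ segment ℝ e.1 e.2 := by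
    rw [hO, segment_eq_image_lineMap]
    exact Set.image_mono fun t ht => ⟨hs0.trans ht.1.le, ht.2.le.trans hs1⟩
  have havoid' : ∀ z ∈ W, (z : ℂ) ∉ openSegment ℝ (a : ℂ) b := by
    intro w hw h
    rw [hO] at h
    obtain ⟨t, ht, e⟩ := h
    exact havoid t ht ⟨w, hw, e.symm⟩
  -- The edge is open in `σ` because what remains of each segment is closed. A segment that meets
  -- the edge cannot meet `e` in one point only, as that point would lie in `W`. So it is collinear
  -- with `e`, and removing the edge means imposing closed conditions on the coordinate along `e`.
  have hclosed : ∀ e' ∈ S, IsClosed (segment ℝ e'.1 e'.2 \ openSegment ℝ (a : ℂ) b) := by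
    intro e' he'
    by_cases hdis : ∃ w ∈ segment ℝ e'.1 e'.2, w ∈ openSegment ℝ (a : ℂ) b
    · obtain ⟨w, hw1, hw2⟩ := hdis
      have hns : ¬ (segment ℝ e.1 e.2 ∩ segment ℝ e'.1 e'.2).Subsingleton := fun h =>
        havoid' ⟨w, hmem e' he' hw1⟩ (hVW (Or.inr (Set.mem_iUnion₂.2 ⟨e, he,
          Set.mem_iUnion₂.2 ⟨e', he', h, hsub hw2, hw1⟩⟩))) hw2
      have hline := segment_subset_line hne hns
      have hval : ∀ t : ℝ, lineFun e.1 (e.2 - e.1) (AffineMap.lineMap e.1 e.2 t)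
          = t * Complex.normSq (e.2 - e.1) := fun t => by
        simpa using lineFun_lineMap_self e.1 e.2 0 t
      have hN := normSq_sub_pos hne
      have heq : segment ℝ e'.1 e'.2 \ openSegment ℝ (a : ℂ) b = segment ℝ e'.1 e'.2 ∩
          ({y | lineFun e.1 (e.2 - e.1) y ≤ s * Complex.normSq (e.2 - e.1)} ∪
            {y | s' * Complex.normSq (e.2 - e.1) ≤ lineFun e.1 (e.2 - e.1) y}) := by
        ext y
        simp only [Set.mem_sdiff, Set.mem_inter_iff, Set.mem_union, Set.mem_ofPred_eq]
        refine and_congr_right fun hy => ?_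
        obtain ⟨t, rfl⟩ := hline y hy
        rw [hval, mul_le_mul_iff_left₀ hN, mul_le_mul_iff_left₀ hN, hO, hinj.mem_set_image,
          Set.mem_Ioo, not_and_or, not_lt, not_lt]
      have hcont : Continuous (lineFun e.1 (e.2 - e.1)) := by unfold lineFun; fun_prop
      rw [heq]
      exact (isClosed_segment _ _).inter ((isClosed_le hcont continuous_const).union
        (isClosed_le continuous_const hcont))
    · push Not at hdis
      rw [sdiff_eq_left.2 (Set.disjoint_left.2 hdis)]
      exact isClosed_segment _ _
  refine ⟨a, b, ⟨ha, hb, ?_, hsub.trans (hmem e he), havoid', ?_⟩, ?_⟩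
  · rintro rfl
    exact hss.ne (hinj (hae.symm.trans hbe))
  · have h1 : IsClosed (⋃ e' ∈ S, (segment ℝ e'.1 e'.2 \ openSegment ℝ (a : ℂ) b)) :=
      S.finite_toSet.isClosed_biUnion hclosed
    convert (h1.preimage continuous_subtype_val).isOpen_compl (X := σ) using 1
    ext w
    have hw : (w : ℂ) ∈ ⋃ e ∈ S, segment ℝ e.1 e.2 := hσ ▸ w.2
    obtain ⟨e', he', hwe⟩ := Set.mem_iUnion₂.1 hw
    simp only [Set.mem_preimage, Set.mem_compl_iff, Set.mem_iUnion, Set.mem_sdiff, not_exists,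
      not_and, not_not]
    exact ⟨fun h _ _ _ => h, fun h => h e' he' hwe⟩
  · rw [hO]; exact ⟨t₀, ⟨hs, hs'⟩, htz⟩

/-! ### Edges are preserved by homeomorphisms -/

/-- The topological properties of the interior `E` of an edge with endpoints `a` and `b`. -/
structure IsTopEdge {X : Type*} [TopologicalSpace X] (W E : Set X) (a b : X) : Prop where
  isOpen : IsOpen E
  isPreconnected : IsPreconnected E
  nonempty : E.Nonempty
  disjoint : Disjoint E W
  left_mem : a ∈ W
  right_mem : b ∈ W
  closure_diff : closure E \ E = {a, b}

namespace IsTopEdge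
variable {X Y : Type*} [TopologicalSpace X] [TopologicalSpace Y] {W E E' : Set X} {a b c d : X}

/-- The connected set `E` is covered by the disjoint open sets `E'` and `(closure E')ᶜ`: the only
points missed are the endpoints of `E'`, which lie in `W` and so not in `E`. -/
theorem subset (h : IsTopEdge W E a b) (h' : IsTopEdge W E' c d) (hne : (E ∩ E').Nonempty) :
    E ⊆ E' := by
  refine h.isPreconnected.subset_left_of_subset_union h'.isOpen isClosed_closure.isOpen_compl
    (disjoint_compl_right.mono_left subset_closure) (fun z hz => ?_) hne
  by_contra hcon
  rw [Set.mem_union, not_or, Set.mem_compl_iff, not_not] at hcon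
  have : z ∈ ({c, d} : Set X) := h'.closure_diff ▸ ⟨hcon.2, hcon.1⟩
  have hzW : z ∈ W := by
    rcases this with rfl | rfl
    · exact h'.left_mem
    · exact h'.right_mem
  exact Set.disjoint_left.1 h.disjoint hz hzW

theorem eq (h : IsTopEdge W E a b) (h' : IsTopEdge W E' c d) (hne : (E ∩ E').Nonempty) :
    E = E' :=
  (h.subset h' hne).antisymm (h'.subset h (Set.inter_comm E E' ▸ hne))

/-- The unordered pair of endpoints is recovered from `E` as `closure E \ E`. -/
theorem endpoints_eq (h : IsTopEdge W E a b) (h' : IsTopEdge W E' c d)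
    (hne : (E ∩ E').Nonempty) : (a = c ∧ b = d) ∨ (a = d ∧ b = c) := by
  rw [← Set.pair_eq_pair_iff, ← h.closure_diff, ← h'.closure_diff, h.eq h' hne]

theorem image (h : IsTopEdge W E a b) (e : X ≃ₜ Y) : IsTopEdge (e '' W) (e '' E) (e a) (e b) where
  isOpen := e.isOpenMap _ h.isOpen
  isPreconnected := e.isPreconnected_image.2 h.isPreconnected
  nonempty := h.nonempty.image e
  disjoint := (Set.disjoint_image_iff e.injective).2 h.disjoint
  left_mem := Set.mem_image_of_mem e h.left_mem
  right_mem := Set.mem_image_of_mem e h.right_mem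
  closure_diff := by
    rw [← e.image_closure, ← Set.image_sdiff e.injective, h.closure_diff, Set.image_pair]

end IsTopEdge

namespace IsEdge
variable {σ τ : Set ℂ} {W : Set σ} {a b c d : σ}

theorem symm (h : IsEdge W a b) : IsEdge W b a where
  left_mem := h.right_mem
  right_mem := h.left_mem
  ne := h.ne.symm
  subset := openSegment_symm ℝ (a : ℂ) b ▸ h.subset
  avoid := openSegment_symm ℝ (a : ℂ) b ▸ h.avoid
  isOpen := openSegment_symm ℝ (a : ℂ) b ▸ h.isOpen

theorem coe_ne (h : IsEdge W a b) : (a : ℂ) ≠ b := fun e => h.ne (Subtype.ext e)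

theorem segment_subset (h : IsEdge W a b) : segment ℝ (a : ℂ) b ⊆ σ := by
  rw [← insert_endpoints_openSegment]
  exact Set.insert_subset a.2 (Set.insert_subset b.2 h.subset)

theorem isTopEdge (h : IsEdge W a b) :
    IsTopEdge W ((↑) ⁻¹' openSegment ℝ (a : ℂ) b : Set σ) a b where
  isOpen := h.isOpen
  isPreconnected := by
    rw [← Topology.IsInducing.subtypeVal.isPreconnected_image, Subtype.image_preimage_coe,
      Set.inter_eq_right.2 h.subset]
    exact (convex_openSegment _ _).isPreconnected
  nonempty := by
    have hm : midpoint ℝ (a : ℂ) b ∈ openSegment ℝ (a : ℂ) b := midpoint_mem_openSegment _ _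
    exact ⟨⟨_, h.subset hm⟩, hm⟩
  disjoint := Set.disjoint_left.2 fun z hz hzW => h.avoid z hzW hz
  left_mem := h.left_mem
  right_mem := h.right_mem
  closure_diff := by
    rw [Topology.IsInducing.subtypeVal.closure_eq_preimage_closure_image,
      Subtype.image_preimage_coe, Set.inter_eq_right.2 h.subset, closure_openSegment]
    ext z
    rw [Set.mem_sdiff, Set.mem_preimage, Set.mem_preimage, ← insert_endpoints_openSegment]
    simp only [Set.mem_insert_iff, Set.mem_singleton_iff, ← Subtype.ext_iff]
    constructor
    · rintro ⟨h1 | h1 | h1, h2⟩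
      · exact Or.inl h1
      · exact Or.inr h1
      · exact absurd h1 h2
    · rintro (rfl | rfl)
      · exact ⟨Or.inl rfl, h.avoid _ h.left_mem⟩
      · exact ⟨Or.inr (Or.inl rfl), h.avoid _ h.right_mem⟩

theorem endpoints_eq (h : IsEdge W a b) (h' : IsEdge W c d) {z : ℂ}
    (hz : z ∈ openSegment ℝ (a : ℂ) b) (hz' : z ∈ openSegment ℝ (c : ℂ) d) :
    (a = c ∧ b = d) ∨ (a = d ∧ b = c) :=
  h.isTopEdge.endpoints_eq h'.isTopEdge ⟨⟨z, h.subset hz⟩, hz, hz'⟩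

/-- The image of the open edge under `e` may be curved in principle, but it is still a topological
edge for `e '' W`. So is the straight edge of `τ` through one of its points; hence both have the
same endpoints. -/
theorem image (h : IsEdge W a b) (e : σ ≃ₜ τ)
    (hcov : ∀ w ∉ e '' W, ∃ c d, IsEdge (e '' W) c d ∧ (w : ℂ) ∈ openSegment ℝ (c : ℂ) d) :
    IsEdge (e '' W) (e a) (e b) := by
  have h1 := h.isTopEdge.image e
  obtain ⟨w, hw⟩ := h1.nonempty
  obtain ⟨c, d, hcd, hwcd⟩ := hcov w (Set.disjoint_left.1 h1.disjoint hw)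
  rcases h1.endpoints_eq hcd.isTopEdge ⟨w, hw, hwcd⟩ with ⟨rfl, rfl⟩ | ⟨rfl, rfl⟩
  · exact hcd
  · exact hcd.symm

end IsEdge

/-- An enumeration, with orientations, of all the edges determined by `W`. -/
structure EdgeList {σ : Set ℂ} (W : Set σ) (m : ℕ) (A B : Fin m → σ) : Prop where
  isEdge : ∀ k, IsEdge W (A k) (B k)
  injective : ∀ j k, (A j = A k ∧ B j = B k) ∨ (A j = B k ∧ B j = A k) → j = k
  cover : ∀ z ∉ W, ∃ k, (z : ℂ) ∈ openSegment ℝ (A k : ℂ) (B k)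

theorem exists_edgeList {σ : Set ℂ} {W : Set σ} (hW : W.Finite)
    (hcov : ∀ z ∉ W, ∃ a b, IsEdge W a b ∧ (z : ℂ) ∈ openSegment ℝ (a : ℂ) b) :
    ∃ m A B, EdgeList W m A B := by
  -- An arbitrary well-order selects one orientation of each edge.
  set R : Set (σ × σ) := {p | IsEdge W p.1 p.2 ∧ WellOrderingRel p.1 p.2}
  have hR : R.Finite := (hW.prod hW).subset fun p hp => ⟨hp.1.left_mem, hp.1.right_mem⟩
  have := hR.to_subtype
  obtain ⟨m, ⟨e⟩⟩ := Finite.exists_equiv_fin R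
  refine ⟨m, fun k => (e.symm k).1.1, fun k => (e.symm k).1.2, fun k => (e.symm k).2.1, ?_, ?_⟩
  · rintro j k (⟨h1, h2⟩ | ⟨h1, h2⟩)
    · exact e.symm.injective (Subtype.ext (Prod.ext h1 h2))
    · have hj := (e.symm j).2.2
      rw [h1, h2] at hj
      exact absurd hj (asymm (r := WellOrderingRel) (e.symm k).2.2)
  · intro z hz
    obtain ⟨a, b, hab, hm⟩ := hcov z hz
    rcases trichotomous_of WellOrderingRel a b with h | h | h
    · exact ⟨e ⟨(a, b), hab, h⟩, by simpa using hm⟩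
    · exact absurd h hab.ne
    · exact ⟨e ⟨(b, a), hab.symm, h⟩, by simpa [openSegment_symm ℝ (b : ℂ)] using hm⟩

/-- For the covering, a point `w` lies on a straight edge of `τ` and also on the image of a listed
edge; sharing `w`, the two have the same endpoints. -/
theorem EdgeList.image {σ τ : Set ℂ} {W : Set σ} {m : ℕ} {A B : Fin m → σ}
    (h : EdgeList W m A B) (e : σ ≃ₜ τ)
    (hcov : ∀ w ∉ e '' W, ∃ c d, IsEdge (e '' W) c d ∧ (w : ℂ) ∈ openSegment ℝ (c : ℂ) d) :
    EdgeList (e '' W) m (fun k => e (A k)) (fun k => e (B k)) where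
  isEdge k := (h.isEdge k).image e hcov
  injective j k hjk := h.injective j k (by simpa using hjk)
  cover w hw := by
    obtain ⟨c, d, hcd, hm⟩ := hcov w hw
    have hback : e.symm '' (e '' W) = W := by rw [← Set.image_comp]; simp
    have hz : e.symm w ∉ W := fun h' => hw ⟨_, h', by simp⟩
    obtain ⟨k, hk⟩ := h.cover _ hz
    have h1 := (h.isEdge k).isTopEdge.image e
    have hw' : w ∈ e '' ((↑) ⁻¹' openSegment ℝ (A k : ℂ) (B k) : Set σ) := ⟨_, hk, by simp⟩
    have h2 := ((h.isEdge k).image e hcov)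
    refine ⟨k, ?_⟩
    rcases h1.endpoints_eq hcd.isTopEdge ⟨w, hw', hm⟩ with ⟨h3, h4⟩ | ⟨h3, h4⟩
    · rwa [h3, h4]
    · rwa [h3, h4, openSegment_symm]

/-- The proper representation whose segments are the listed edges. -/
noncomputable def EdgeList.toProperRep {σ : Set ℂ} {W : Set σ} {m : ℕ} {A B : Fin m → σ}
    (h : EdgeList W m A B) (hconn : IsConnected σ) (hnt : σ.Nontrivial) (hW : W.Finite) :
    ProperRep σ m where
  left k := A k
  right k := B k
  left_ne_right _ k := (h.isEdge k).coe_ne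
  union_eq := by
    refine (Set.iUnion_subset fun k => (h.isEdge k).segment_subset).antisymm ?_
    have : ConnectedSpace σ := Subtype.connectedSpace hconn
    have : Nontrivial σ := hnt.coe_sort
    -- A nontrivial connected `σ` has no isolated points, so the complement of the finite set `W` is
    -- dense and the closed union of the edges also contains `W`.
    have hd : Dense (Wᶜ : Set σ) := by
      rw [Set.compl_eq_univ_sdiff]; exact dense_univ.sdiff_finite hW
    have hcl : IsClosed ((↑) ⁻¹' (⋃ k, segment ℝ (A k : ℂ) (B k)) : Set σ) :=
      (isClosed_iUnion_of_finite fun k => isClosed_segment _ _).preimage continuous_subtype_val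
    have hsub : (Wᶜ : Set σ) ⊆ (↑) ⁻¹' (⋃ k, segment ℝ (A k : ℂ) (B k)) := fun z hz => by
      obtain ⟨k, hk⟩ := h.cover z hz
      exact Set.mem_iUnion.2 ⟨k, openSegment_subset_segment ℝ _ _ hk⟩
    intro z hz
    exact hcl.closure_subset_iff.2 hsub (hd ⟨z, hz⟩)
  inter_subset j k hjk := by
    rintro z ⟨hj, hk⟩
    have hWj : z ∈ ({(A j : ℂ), (B j : ℂ)} : Set ℂ) → ∃ w ∈ W, (w : ℂ) = z := by
      rintro (rfl | rfl)
      · exact ⟨_, (h.isEdge j).left_mem, rfl⟩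
      · exact ⟨_, (h.isEdge j).right_mem, rfl⟩
    have hWk : z ∈ ({(A k : ℂ), (B k : ℂ)} : Set ℂ) → ∃ w ∈ W, (w : ℂ) = z := by
      rintro (rfl | rfl)
      · exact ⟨_, (h.isEdge k).left_mem, rfl⟩
      · exact ⟨_, (h.isEdge k).right_mem, rfl⟩
    have hor : ∀ i, z ∈ segment ℝ (A i : ℂ) (B i) →
        z ∈ ({(A i : ℂ), (B i : ℂ)} : Set ℂ) ∨ z ∈ openSegment ℝ (A i : ℂ) (B i) := by
      intro i hi
      rw [← insert_endpoints_openSegment] at hi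
      rcases hi with h1 | h1 | h1
      · exact Or.inl (Or.inl h1)
      · exact Or.inl (Or.inr h1)
      · exact Or.inr h1
    rcases hor j hj with h1 | h1 <;> rcases hor k hk with h2 | h2
    · exact ⟨h1, h2⟩
    · obtain ⟨w, hw, rfl⟩ := hWj h1
      exact absurd h2 ((h.isEdge k).avoid w hw)
    · obtain ⟨w, hw, rfl⟩ := hWk h2
      exact absurd h1 ((h.isEdge j).avoid w hw)
    · exact absurd (h.injective j k ((h.isEdge j).endpoints_eq (h.isEdge k) h1 h2)) hjk

/-! ### The segmentwise affine homeomorphism -/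

/-- `φ` carries the standard parametrization of each segment of `r` to that of the corresponding
segment of `q`. -/
def MapsParam {σ τ : Set ℂ} {m : ℕ} (r : ProperRep σ m) (q : ProperRep τ m) (φ : σ ≃ₜ τ) : Prop :=
  ∀ k, ∀ t ∈ Set.Icc (0 : ℝ) 1, ∀ z : σ, (z : ℂ) = AffineMap.lineMap (r.left k) (r.right k) t →
    (φ z : ℂ) = AffineMap.lineMap (q.left k) (q.right k) t

namespace ProperRep
variable {σ τ : Set ℂ} {m : ℕ}

theorem lineMap_mem (r : ProperRep σ m) (k : Fin m) {t : ℝ} (ht : t ∈ Set.Icc (0 : ℝ) 1) :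
    (AffineMap.lineMap (r.left k) (r.right k) t : ℂ) ∈ σ :=
  r.seg_subset k (by rw [seg, segment_eq_image_lineMap]; exact ⟨t, ht, rfl⟩)

/-- The joint parametrization of all segments. -/
noncomputable def param (r : ProperRep σ m) (p : Fin m × Set.Icc (0 : ℝ) 1) : σ :=
  ⟨AffineMap.lineMap (r.left p.1) (r.right p.1) (p.2 : ℝ), r.lineMap_mem p.1 p.2.2⟩

theorem continuous_param (r : ProperRep σ m) : Continuous r.param := by
  refine Continuous.subtype_mk ?_ _
  have h1 : Continuous fun p : Fin m × Set.Icc (0 : ℝ) 1 => r.left p.1 :=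
    continuous_of_discreteTopology.comp continuous_fst
  have h2 : Continuous fun p : Fin m × Set.Icc (0 : ℝ) 1 => r.right p.1 :=
    continuous_of_discreteTopology.comp continuous_fst
  simp only [AffineMap.lineMap_apply, vsub_eq_sub, vadd_eq_add]
  fun_prop

theorem surjective_param (r : ProperRep σ m) : Function.Surjective r.param := by
  intro z
  have hz : (z : ℂ) ∈ ⋃ k, segment ℝ (r.left k) (r.right k) := r.union_eq.ge z.2
  obtain ⟨k, hk⟩ := Set.mem_iUnion.1 hz
  rw [segment_eq_image_lineMap] at hk
  obtain ⟨t, ht, e⟩ := hk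
  exact ⟨(k, ⟨t, ht⟩), Subtype.ext e⟩

/-- A continuous surjection from a compact space onto a Hausdorff space is a quotient map;
continuous maps on `σ` can thus be defined on the parameters. -/
theorem isQuotientMap_param (r : ProperRep σ m) : Topology.IsQuotientMap r.param :=
  .of_surjective_continuous r.surjective_param r.continuous_param

/-- On one segment the parametrization is injective. Distinct segments are glued only at endpoints,
and there `q` makes the same identifications because its endpoints are the values of `h` at those of
`r`. -/
theorem param_eq_iff (r : ProperRep σ m) (hσ : σ.Nontrivial) (q : ProperRep τ m)
    {h : σ → τ} {A B : Fin m → σ} (hA : ∀ k, r.left k = A k) (hB : ∀ k, r.right k = B k)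
    (hA' : ∀ k, q.left k = h (A k)) (hB' : ∀ k, q.right k = h (B k))
    {x y : Fin m × Set.Icc (0 : ℝ) 1} (hxy : r.param x = r.param y) : q.param x = q.param y := by
  obtain ⟨j, s⟩ := x
  obtain ⟨k, t⟩ := y
  have hxy' : (AffineMap.lineMap (r.left j) (r.right j) (s : ℝ) : ℂ)
      = AffineMap.lineMap (r.left k) (r.right k) (t : ℝ) := congrArg Subtype.val hxy
  rcases eq_or_ne j k with rfl | hjk
  · have := AffineMap.lineMap_injective ℝ (r.left_ne_right hσ j) hxy'
    rw [Subtype.ext this]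
  · have hmem : ∀ (i : Fin m) (u : Set.Icc (0 : ℝ) 1),
        (AffineMap.lineMap (r.left i) (r.right i) (u : ℝ) : ℂ)
          ∈ segment ℝ (r.left i) (r.right i) := fun i u => by
      rw [segment_eq_image_lineMap]; exact ⟨u, u.2, rfl⟩
    obtain ⟨h1, h2⟩ := r.inter_subset j k hjk ⟨hmem j s, hxy' ▸ hmem k t⟩
    have key : ∀ (i : Fin m) (u : Set.Icc (0 : ℝ) 1),
        (AffineMap.lineMap (r.left i) (r.right i) (u : ℝ) : ℂ) ∈ ({r.left i, r.right i} : Set ℂ) →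
        q.param (i, u) = h (r.param (i, u)) := by
      intro i u hu
      have hinj := AffineMap.lineMap_injective ℝ (r.left_ne_right hσ i)
      rcases hu with hu | hu
      · have h0 : (u : ℝ) = 0 := hinj (hu.trans (AffineMap.lineMap_apply_zero _ _).symm)
        have e : r.param (i, u) = A i := Subtype.ext (hu.trans (hA i))
        rw [e]
        exact Subtype.ext (by simp [param, h0, hA'])
      · have h0 : (u : ℝ) = 1 := hinj (hu.trans (AffineMap.lineMap_apply_one _ _).symm)
        have e : r.param (i, u) = B i := Subtype.ext (hu.trans (hB i))
        rw [e]
        exact Subtype.ext (by simp [param, h0, hB'])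
    rw [key j s h1, key k t (hxy' ▸ h2), hxy]

/-- Each joint parametrization factors through the other, and the two induced maps are inverse to
each other. Only the endpoint values of the bijection `h` matter. -/
theorem exists_homeomorph_mapsParam (r : ProperRep σ m) (q : ProperRep τ m) (hσ : σ.Nontrivial)
    (hτ : τ.Nontrivial) (h : σ ≃ τ) {A B : Fin m → σ} (hA : ∀ k, r.left k = A k)
    (hB : ∀ k, r.right k = B k) (hA' : ∀ k, q.left k = h (A k)) (hB' : ∀ k, q.right k = h (B k)) :
    ∃ φ : σ ≃ₜ τ, MapsParam r q φ := by
  have f1 : Function.FactorsThrough (⟨q.param, q.continuous_param⟩ : C(_, τ))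
      (⟨r.param, r.continuous_param⟩ : C(_, σ)) := fun x y hxy =>
    r.param_eq_iff hσ q hA hB hA' hB' hxy
  have f2 : Function.FactorsThrough (⟨r.param, r.continuous_param⟩ : C(_, σ))
      (⟨q.param, q.continuous_param⟩ : C(_, τ)) := fun x y hxy =>
    q.param_eq_iff hτ r (h := h.symm) hA' hB' (fun k => by simp [hA]) (fun k => by simp [hB]) hxy
  have hr : Topology.IsQuotientMap (⟨r.param, r.continuous_param⟩ : C(_, σ)) :=
    r.isQuotientMap_param
  have hq : Topology.IsQuotientMap (⟨q.param, q.continuous_param⟩ : C(_, τ)) :=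
    q.isQuotientMap_param
  have e1 : ∀ x, hr.lift _ f1 (r.param x) = q.param x := fun x =>
    DFunLike.congr_fun (hr.lift_comp _ f1) x
  have e2 : ∀ x, hq.lift _ f2 (q.param x) = r.param x := fun x =>
    DFunLike.congr_fun (hq.lift_comp _ f2) x
  refine ⟨⟨⟨hr.lift _ f1, hq.lift _ f2, fun z => ?_, fun w => ?_⟩, map_continuous _,
    map_continuous _⟩, fun k t ht z hz => ?_⟩
  · obtain ⟨x, rfl⟩ := r.surjective_param z
    rw [e1, e2]
  · obtain ⟨x, rfl⟩ := q.surjective_param w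
    rw [e2, e1]
  · have : z = r.param (k, ⟨t, ht⟩) := Subtype.ext hz
    subst this
    exact congrArg Subtype.val (e1 (k, ⟨t, ht⟩))

end ProperRep

theorem MapsParam.isSegmentwiseAffine {σ τ : Set ℂ} {m : ℕ} {r : ProperRep σ m}
    {q : ProperRep τ m} {φ : σ ≃ₜ τ} (h : MapsParam r q φ) : IsSegmentwiseAffine r q φ := by
  intro k
  set a := r.left k
  set b := r.right k
  set c := q.left k
  set d := q.right k
  have hcd : a = b → c = d := by
    intro hab
    have h0 := h k 0 ⟨le_rfl, zero_le_one⟩ ⟨_, r.lineMap_mem k ⟨le_rfl, zero_le_one⟩⟩ rfl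
    have h1 := h k 1 ⟨zero_le_one, le_rfl⟩ ⟨_, r.lineMap_mem k ⟨le_rfl, zero_le_one⟩⟩
      (by change (AffineMap.lineMap a b (0 : ℝ) : ℂ) = AffineMap.lineMap a b (1 : ℝ); simp [hab])
    rw [h0] at h1
    change (AffineMap.lineMap c d (0 : ℝ) : ℂ) = AffineMap.lineMap c d (1 : ℝ) at h1
    simpa using h1
  -- The complex-affine map with `a ↦ c` and `b ↦ d`. If `a = b` the quotient is zero by convention,
  -- and the constant map serves because `c = d`.
  let A : ℂ →ᵃ[ℝ] ℂ :=
    { toFun := fun z => c + (d - c) / (b - a) * (z - a)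
      linear := LinearMap.mulLeft ℝ ((d - c) / (b - a))
      map_vadd' := fun p v => by simp; ring }
  have hAa : A a = c := by simp [A]
  have hAb : A b = d := by
    change c + (d - c) / (b - a) * (b - a) = d
    rcases eq_or_ne a b with hab | hab
    · simp [hab, hcd hab]
    · rw [div_mul_cancel₀ _ (sub_ne_zero.2 hab.symm)]; ring
  refine ⟨A, fun z hz => ?_, ?_⟩
  · rw [ProperRep.seg, segment_eq_image_lineMap] at hz
    obtain ⟨t, ht, e⟩ := hz
    rw [h k t ht z e.symm, ← e, AffineMap.apply_lineMap, hAa, hAb]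
  · rw [ProperRep.seg, ProperRep.seg, image_segment, hAa, hAb]

theorem supNorm_comp_equiv {σ τ : Set ℂ} (e : τ ≃ σ) (f : σ → ℂ) : supNorm (f ∘ e) = supNorm f :=
  e.iSup_comp (g := fun z => ‖f z‖ₑ)

/-- On corresponding segments `f` and `f ∘ φ.symm` become the same function of the parameter, so
their variations agree by `var_segment_eq`. -/
theorem MapsParam.lgNorm_eq {σ τ : Set ℂ} {m : ℕ} {r : ProperRep σ m} {q : ProperRep τ m}
    {φ : σ ≃ₜ τ} (h : MapsParam r q φ) (f : σ → ℂ) : q.lgNorm (f ∘ φ.symm) = r.lgNorm f := by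
  have hs := supNorm_comp_equiv φ.symm.toEquiv f
  change supNorm (f ∘ φ.symm) = _ at hs
  rcases σ.subsingleton_or_nontrivial with hσ | hσ
  · have hτ : τ.Subsingleton := by
      have := hσ.coe_sort
      exact (Set.subsingleton_coe τ).1 φ.symm.injective.subsingleton
    rw [r.lgNorm_eq_of_subsingleton hσ, q.lgNorm_eq_of_subsingleton hτ, hs]
  have hτ : τ.Nontrivial := by
    have := hσ.coe_sort
    exact Set.nontrivial_coe_sort.1 φ.injective.nontrivial
  obtain ⟨F, hf, hF⟩ := ProperRep.exists_lgNorm_eq f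
  obtain ⟨G, hg, hG⟩ := ProperRep.exists_lgNorm_eq (f ∘ φ.symm)
  rw [hF, hG, hs]
  congr 1
  refine Finset.sum_congr rfl fun k _ => ?_
  rw [var_segment_eq (r.left_ne_right hσ k), var_segment_eq (q.left_ne_right hτ k)]
  refine eVariationOn.congr fun t ht => ?_
  have e1 := congrFun hf ⟨_, r.lineMap_mem k ht⟩
  have e2 := congrFun hg (φ ⟨_, r.lineMap_mem k ht⟩)
  simp only [Function.comp_apply, Homeomorph.symm_apply_apply] at e2
  rw [h k t ht _ rfl] at e2
  exact e2.symm.trans e1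

/-- Homeomorphic linear graphs have proper representations matched by a homeomorphism. -/
theorem exists_mapsParam {σ τ : Set ℂ} (hσ : IsLG σ) (hτ : IsLG τ) (h : σ ≃ₜ τ) :
    ∃ (m : ℕ) (r : ProperRep σ m) (q : ProperRep τ m) (φ : σ ≃ₜ τ), MapsParam r q φ := by
  rcases σ.subsingleton_or_nontrivial with hs | hnt
  · obtain ⟨p, hp⟩ := hσ.2.1.nonempty
    have hσp : σ = {p} := hs.eq_singleton_of_mem hp
    have hts : τ.Subsingleton := by
      have := hs.coe_sort
      exact (Set.subsingleton_coe τ).1 h.symm.injective.subsingleton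
    obtain ⟨w, hw⟩ := hτ.2.1.nonempty
    have hτw : τ = {w} := hts.eq_singleton_of_mem hw
    refine ⟨1,
      { left := fun _ => p
        right := fun _ => p
        left_ne_right := fun h => absurd hs (Set.not_subsingleton_iff.2 h)
        union_eq := by simp [hσp, segment_same]
        inter_subset := fun j k hjk => absurd (Subsingleton.elim j k) hjk },
      { left := fun _ => w
        right := fun _ => w
        left_ne_right := fun h => absurd hts (Set.not_subsingleton_iff.2 h)
        union_eq := by simp [hτw, segment_same]
        inter_subset := fun j k hjk => absurd (Subsingleton.elim j k) hjk }, h, ?_⟩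
    intro k t _ z _
    simpa using hts (h z).2 hw
  · have hntτ : τ.Nontrivial := by
      have := hnt.coe_sort
      exact Set.nontrivial_coe_sort.1 h.injective.nontrivial
    obtain ⟨-, hcσ, S, hS⟩ := hσ
    obtain ⟨-, hcτ, S', hS'⟩ := hτ
    obtain ⟨V, hVf, hV⟩ := exists_subdivision S hS
    obtain ⟨V', hVf', hV'⟩ := exists_subdivision S' hS'
    -- With the vertices of both graphs included, `W` subdivides `σ` and `h '' W` subdivides `τ`.
    set W : Set σ := V ∪ h ⁻¹' V'
    have hW : W.Finite := hVf.union (hVf'.preimage h.injective.injOn)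
    have hsub : V' ⊆ h '' W := fun w hw => ⟨h.symm w, Or.inr (by simpa using hw), by simp⟩
    obtain ⟨m, A, B, hAB⟩ := exists_edgeList hW (hV W hW Set.subset_union_left)
    have hAB' := hAB.image h (hV' _ (hW.image h) hsub)
    obtain ⟨φ, hφ⟩ := (hAB.toProperRep hcσ hnt hW).exists_homeomorph_mapsParam
      (hAB'.toProperRep hcτ hntτ (hW.image h)) hnt hntτ h.toEquiv (A := A) (B := B)
      (fun _ => rfl) (fun _ => rfl) (fun _ => rfl) (fun _ => rfl)
    exact ⟨m, _, _, φ, hφ⟩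

theorem MapsParam.symm {σ τ : Set ℂ} {m : ℕ} {r : ProperRep σ m} {q : ProperRep τ m}
    {φ : σ ≃ₜ τ} (h : MapsParam r q φ) : MapsParam q r φ.symm := by
  intro k t ht w hw
  have h1 := h k t ht ⟨_, r.lineMap_mem k ht⟩ rfl
  have h2 : w = φ ⟨_, r.lineMap_mem k ht⟩ := Subtype.ext (hw.trans h1.symm)
  rw [h2, Homeomorph.symm_apply_apply]

/-- Pass to the `LG` norm on `τ`, carry it over to `σ` unchanged, and return to the variation norm
there; the constant is the product of the two comparison constants. -/
theorem MapsParam.bvNorm_le {σ τ : Set ℂ} {m : ℕ} {r : ProperRep σ m} {q : ProperRep τ m}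
    {φ : σ ≃ₜ τ} (h : MapsParam r q φ) (f : σ → ℂ) :
    bvNorm (f ∘ φ.symm) ≤ (((18 * m + 1) * (m + 1) : ℕ) : ℝ≥0∞) * bvNorm f := by
  refine (q.bvNorm_le _).trans ?_
  rw [h.lgNorm_eq]
  push_cast
  rw [mul_assoc]
  gcongr
  exact r.lgNorm_le f

/-! ### Composition operators -/

/-- Composition with a map between the domains that is bounded for the variation norms. -/
noncomputable def BV.compHom {σ τ : Set ℂ} (e : τ → σ) (C : ℕ)
    (h : ∀ f : σ → ℂ, bvNorm (f ∘ e) ≤ C * bvNorm f) : BV σ →ₐ[ℂ] BV τ where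
  toFun f := (⟨f ∘ e, (h f).trans_lt (ENNReal.mul_lt_top (ENNReal.natCast_lt_top C)
    (BV.bvNorm_lt_top f))⟩ : bvSubalgebra τ)
  map_one' := rfl
  map_mul' _ _ := rfl
  map_zero' := rfl
  map_add' _ _ := rfl
  commutes' _ := rfl

theorem BV.compHom_apply {σ τ : Set ℂ} (e : τ → σ) (C : ℕ)
    (h : ∀ f : σ → ℂ, bvNorm (f ∘ e) ≤ C * bvNorm f) (f : BV σ) (w : τ) :
    BV.compHom e C h f w = f (e w) := rfl

theorem BV.continuous_compHom {σ τ : Set ℂ} (e : τ → σ) (C : ℕ)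
    (h : ∀ f : σ → ℂ, bvNorm (f ∘ e) ≤ C * bvNorm f) : Continuous (BV.compHom e C h) := by
  refine AddMonoidHomClass.continuous_of_bound (BV.compHom e C h) C fun f => ?_
  rw [BV.norm_def, BV.norm_def, ← ENNReal.toReal_natCast, ← ENNReal.toReal_mul]
  exact ENNReal.toReal_mono
    (ENNReal.mul_lt_top (ENNReal.natCast_lt_top C) (BV.bvNorm_lt_top f)).ne (h f)

/-- The isomorphism of Banach algebras induced by a homeomorphism that matches two proper
representations. -/
noncomputable def MapsParam.bvEquiv {σ τ : Set ℂ} {m : ℕ} {r : ProperRep σ m} {q : ProperRep τ m}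
    {φ : σ ≃ₜ τ} (h : MapsParam r q φ) : BV σ ≃A[ℂ] BV τ where
  toAlgEquiv := AlgEquiv.ofAlgHom (BV.compHom φ.symm _ h.bvNorm_le)
    (BV.compHom φ.symm.symm _ h.symm.bvNorm_le)
    (AlgHom.ext fun f => DFunLike.ext _ _ fun w => by
      simp [BV.compHom_apply]) (AlgHom.ext fun f => DFunLike.ext _ _ fun w => by
      simp [BV.compHom_apply])
  continuous_toFun := BV.continuous_compHom _ _ _
  continuous_invFun := BV.continuous_compHom _ _ _

theorem MapsParam.bvEquiv_apply {σ τ : Set ℂ} {m : ℕ} {r : ProperRep σ m} {q : ProperRep τ m}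
    {φ : σ ≃ₜ τ} (h : MapsParam r q φ) (f : BV σ) : ⇑(h.bvEquiv f) = f ∘ φ.symm := rfl

end PlaneBV

theorem mainTheorem3 {σ τ : Set ℂ} (hσ : PlaneBV.IsLG σ) (hτ : PlaneBV.IsLG τ)
    (hστ : Nonempty (σ ≃ₜ τ)) :
    ∃ (m : ℕ) (r : PlaneBV.ProperRep σ m) (q : PlaneBV.ProperRep τ m) (φ : σ ≃ₜ τ)
      (Φ : PlaneBV.BV σ ≃A[ℂ] PlaneBV.BV τ),
      PlaneBV.IsSegmentwiseAffine r q φ ∧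
      (∀ (f : PlaneBV.BV σ) (w : τ), Φ f w = f (φ.symm w)) ∧
      (∀ (m₁ m₂ : ℕ) (r₁ : PlaneBV.ProperRep σ m₁) (r₂ : PlaneBV.ProperRep τ m₂)
        (f : PlaneBV.BV σ),
        r₁.lgNorm f < ⊤ ∧ r₂.lgNorm (Φ f) = r₁.lgNorm f) := by
  obtain ⟨m, r, q, φ, h⟩ := PlaneBV.exists_mapsParam hσ hτ hστ.some
  refine ⟨m, r, q, φ, h.bvEquiv, h.isSegmentwiseAffine, fun f w => rfl,
    fun m₁ m₂ r₁ r₂ f => ⟨?_, ?_⟩⟩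
  · refine (r₁.lgNorm_le f).trans_lt (ENNReal.mul_lt_top ?_ (PlaneBV.BV.bvNorm_lt_top f))
    exact_mod_cast ENNReal.natCast_lt_top (m₁ + 1)
  -- Independence of the representation reduces the claim to the matched pair `q`, `r`, for which
  -- `φ` preserves the norm.
  · rw [h.bvEquiv_apply, r₂.lgNorm_eq q, h.lgNorm_eq, r.lgNorm_eq r₁]
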